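/- Let $(G,\gamma)$ be a $\mathbb{Z}/2$-colored graph, i.e. a finite directed multigraph (loops and parallel edges allowed) with a color $\gamma_e\in\mathbb{Z}/2$ on every edge $e$, having $n$ vertices and $2n-1$ edges. Let $\tilde G$ be its symmetric lift: each vertex $i$ lifts to $\tilde i_0,\tilde i_1$, each edge $e$ from $i$ to $j$ lifts to the edges $\tilde i_{0}\tilde j_{\gamma_e}$, $\tilde i_{1}\tilde j_{1+\gamma_e}$, and $\mathbb{Z}/2$ acts freely by exchanging the two lifts; $\mathbb{Z}/2$ acts on $\mathbb{R}^2$ by the reflection $\sigma$ in the $y$-axis. A reflection direction network on $\tilde G$ is an assignment $d$ of directions (nonzero vectors up to scalars) to the edges of $\tilde G$ that is symmetric under these actions; $d^\perp$ is obtained by turning all directions by $\pi/2$. A realization of the network on $d$ is an assignment of points $p_v\in\mathbb{R}^2$ to the vertices of $\tilde G$ such that $p_{\tilde i_1}=\sigma\, p_{\tilde i_0}$ for all $i$ and $\langle p_v-p_u,d_{uv}^\perp\rangle=0$ for every edge $uv$ of $\tilde G$. It is faithful if no edge of $\tilde G$ has coincident endpoints, and collapsed if all the points coincide. For a subgraph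 consisting of a set of edges of $G$ and their endpoints, let $m'$ and $n'$ be its numbers of edges and vertices, $c'_0$ the number of its connected components all of whose cycles have color sum $0$ in $\mathbb{Z}/2$, and $c'$ the number of its other connected components. $(G,\gamma)$ is reflection-Laman if $G$ has $2n-1$ edges and $m'\le 2n'-c'-3c'_0$ for all such subgraphs. A Ross graph on $n$ vertices is a colored graph with $2n-2$ edges such that $m'\le 2n'-2c'-3c'_0$ for all such subgraphs. (i) There are directions $d$ such that the network on $d$ has a faithful realization and the network on $d^\perp$ has only collapsed realizations if and only if $(G,\gamma)$ is reflection-Laman. (ii) There are directions $d$ such that the network on $d$ has a faithful realization that is unique up to (nonzero) scale and vertical translation and the network on $d^\perp$ has only collapsed realizations if and only if $(G,\gamma)$ is reflection-Laman and has a spanning subgraph (all $n$ vertices, some of the edges) that is a Ross graph. -/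

import Mathlib

/-- A `ℤ/2`-colored graph: a directed multigraph (loops and parallel edges allowed) with
vertex type `V` and edge type `E`, and an element of `ℤ/2` on every edge. -/
structure ColoredGraph (V : Type*) (E : Type*) where
  /-- the tail of an edge -/
  src : E → V
  /-- the head of an edge -/
  tgt : E → V
  /-- the color of an edge -/
  color : E → ZMod 2

namespace ColoredGraph

variable {V : Type*} {E : Type*} (G : ColoredGraph V E)

/-! ### The map `ρ` and the sparsity counts

A subgraph is given by its set of edges `F`; its vertices are the endpoints of these edges. -/

/-- The simplicial boundary map of the graph, from 1-chains to 0-chains. -/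
noncomputable def boundary : (E →₀ ℤ) →ₗ[ℤ] (V →₀ ℤ) :=
  Finsupp.linearCombination ℤ
    (fun e => Finsupp.single (G.tgt e) (1 : ℤ) - Finsupp.single (G.src e) (1 : ℤ))

/-- `H₁(F, ℤ)`: the integral cycles supported on the edge set `F`. -/
noncomputable def cycles (F : Set E) : Submodule ℤ (E →₀ ℤ) :=
  Finsupp.supported ℤ ℤ F ⊓ LinearMap.ker G.boundary

/-- The map `ρ`: add up the colors along a chain, with signs. -/
noncomputable def rho : (E →₀ ℤ) →ₗ[ℤ] ZMod 2 :=
  Finsupp.linearCombination ℤ G.color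

/-- The `ρ`-image of the subgraph `F` is trivial. -/
def TrivialRho (F : Set E) : Prop :=
  (G.cycles F).map G.rho = ⊥

/-- The vertices spanned by the edge set `F`. -/
def spannedVertices (F : Set E) : Set V :=
  G.src '' F ∪ G.tgt '' F

/-- The equivalence relation on vertices "joined by a path with edges in `F`". -/
def connSetoid (F : Set E) : Setoid V :=
  Relation.EqvGen.setoid (fun u v => ∃ e ∈ F, G.src e = u ∧ G.tgt e = v)

/-- The connected component of the subgraph `F` containing the vertex `v`. -/
def componentOf (F : Set E) (v : V) : Quotient (G.connSetoid F) :=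
  Quotient.mk (G.connSetoid F) v

/-- The connected components of the subgraph `F` (as a graph on the vertices it spans). -/
def components (F : Set E) : Set (Quotient (G.connSetoid F)) :=
  G.componentOf F '' G.spannedVertices F

/-- The edges of a connected component of the subgraph `F`. -/
def componentEdges (F : Set E) (c : Quotient (G.connSetoid F)) : Set E :=
  {e | e ∈ F ∧ G.componentOf F (G.src e) = c}

/-- The number of connected components of `F` with non-trivial `ρ`-image. -/
noncomputable def numNontrivial (F : Set E) : ℕ :=
  {c | c ∈ G.components F ∧ ¬ G.TrivialRho (G.componentEdges F c)}.ncard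

/-- The number of connected components of `F` with trivial `ρ`-image. -/
noncomputable def numTrivial (F : Set E) : ℕ :=
  {c | c ∈ G.components F ∧ G.TrivialRho (G.componentEdges F c)}.ncard

/-- Reflection-Laman graphs: `m = 2n - 1`, and `m' ≤ 2n' - c' - 3c₀'` for all subgraphs. -/
def IsReflectionLaman : Prop :=
  (Nat.card E : ℤ) = 2 * Nat.card V - 1 ∧
    ∀ F : Set E,
      (F.ncard : ℤ) ≤
        2 * (G.spannedVertices F).ncard - G.numNontrivial F - 3 * G.numTrivial F

/-- The spanning subgraph with edge set `B` (and all of `V` as vertices) is a Ross graph: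
it has `2n - 2` edges, and `m' ≤ 2n' - 2c' - 3c₀'` for all its subgraphs. -/
def IsRossSubgraph (B : Set E) : Prop :=
  (B.ncard : ℤ) = 2 * Nat.card V - 2 ∧
    ∀ F : Set E, F ⊆ B →
      (F.ncard : ℤ) ≤
        2 * (G.spannedVertices F).ncard - 2 * G.numNontrivial F - 3 * G.numTrivial F

/-! ### The symmetric lift

The lift has vertices `V × ℤ/2` and edges `E × ℤ/2`. -/

/-- The tail of an edge of the lift. -/
def liftSrc (e : E × ZMod 2) : V × ZMod 2 := (G.src e.1, e.2)

/-- The head of an edge of the lift. -/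
def liftTgt (e : E × ZMod 2) : V × ZMod 2 := (G.tgt e.1, e.2 + G.color e.1)

end ColoredGraph

/-- The free action of `ℤ/2` on the vertices, and on the edges, of the lift. -/
def liftAct {X : Type*} (g : ZMod 2) (x : X × ZMod 2) : X × ZMod 2 := (x.1, g + x.2)

/-! ### The plane -/

/-- The Euclidean plane. -/
abbrev Plane : Type := EuclideanSpace ℝ (Fin 2)

/-- Counter-clockwise rotation by `π/2`. -/
noncomputable def perp (v : Plane) : Plane := !₂[-v 1, v 0]

/-- Reflection through the vertical axis. -/
noncomputable def reflY (v : Plane) : Plane := !₂[-v 0, v 1]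

/-- The action of `ℤ/2` on the plane generated by the reflection through the vertical axis. -/
noncomputable def planeAct (g : ZMod 2) (v : Plane) : Plane := if g = 0 then v else reflY v

theorem perp_ne_zero {v : Plane} (hv : v ≠ 0) : perp v ≠ 0 := by
  intro h
  apply hv
  have h0 := congrArg (fun w : Plane => w 0) h
  have h1 := congrArg (fun w : Plane => w 1) h
  ext i
  fin_cases i <;> simp_all [perp]

theorem perp_smul (c : ℝ) (v : Plane) : perp (c • v) = c • perp v := by
  ext i
  fin_cases i <;> simp [perp]

theorem perp_planeAct (g : ZMod 2) (v : Plane) :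
    ∃ c : ℝ, perp (planeAct g v) = c • planeAct g (perp v) := by
  by_cases hg : g = 0
  · exact ⟨1, by simp [planeAct, hg]⟩
  · refine ⟨-1, ?_⟩
    ext i
    fin_cases i <;> simp [planeAct, hg, perp, reflY]

/-! ### Reflection direction networks -/

/-- A reflection direction network on the lift of a colored graph with edge type `E`: a symmetric
assignment of directions to the edges of the lift. A direction is a line through the origin, given
by a nonzero vector up to scalars, and symmetry is an equality of lines. -/
structure DirectionNetwork (E : Type*) where
  /-- a vector spanning the direction of an edge of the lift -/
  dir : E × ZMod 2 → Plane
  dir_ne_zero : ∀ e, dir e ≠ 0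
  dir_symm : ∀ (g : ZMod 2) (e : E × ZMod 2), ∃ c : ℝ, dir (liftAct g e) = c • planeAct g (dir e)

namespace DirectionNetwork

variable {V : Type*} {E : Type*}

/-- The direction network with all directions turned by `π/2`. -/
noncomputable def perp (d : DirectionNetwork E) : DirectionNetwork E where
  dir e := _root_.perp (d.dir e)
  dir_ne_zero e := perp_ne_zero (d.dir_ne_zero e)
  dir_symm g e := by
    obtain ⟨c, hc⟩ := d.dir_symm g e
    obtain ⟨c', hc'⟩ := perp_planeAct g (d.dir e)
    exact ⟨c * c', by rw [hc, perp_smul, hc', smul_smul]⟩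

/-- `p` is a realization of the direction network `d` on the lift of `G`. -/
def IsRealization (d : DirectionNetwork E) (G : ColoredGraph V E) (p : V × ZMod 2 → Plane) :
    Prop :=
  (∀ e : E × ZMod 2,
    inner ℝ (p (G.liftTgt e) - p (G.liftSrc e)) (_root_.perp (d.dir e)) = 0) ∧
  ∀ (g : ZMod 2) (i : V × ZMod 2), p (liftAct g i) = planeAct g (p i)

/-- A faithful realization: no edge of the lift has coincident endpoints. -/
def IsFaithfulRealization (d : DirectionNetwork E) (G : ColoredGraph V E)
    (p : V × ZMod 2 → Plane) : Prop :=
  d.IsRealization G p ∧ ∀ e : E × ZMod 2, p (G.liftSrc e) ≠ p (G.liftTgt e)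

/-- All realizations are collapsed: all vertices of the lift are at the same point. -/
def OnlyCollapsed (d : DirectionNetwork E) (G : ColoredGraph V E) : Prop :=
  ∀ p : V × ZMod 2 → Plane, d.IsRealization G p → ∀ i j, p i = p j

/-- The direction network has a faithful realization. -/
def HasFaithful (d : DirectionNetwork E) (G : ColoredGraph V E) : Prop :=
  ∃ p : V × ZMod 2 → Plane, d.IsFaithfulRealization G p

/-- The direction network has a faithful realization, which is unique up to scale and vertical
translation. -/
def HasUniqueFaithful (d : DirectionNetwork E) (G : ColoredGraph V E) : Prop :=
  ∃ p : V × ZMod 2 → Plane, d.IsFaithfulRealization G p ∧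
    ∀ q : V × ZMod 2 → Plane, d.IsFaithfulRealization G q →
      ∃ c t : ℝ, c ≠ 0 ∧ ∀ i, q i = c • p i + !₂[0, t]

end DirectionNetwork

/-! A symmetric configuration is determined by one point per vertex of `G`. So both networks become
linear systems on `V → ℝ × ℝ` with one equation per edge: `detForm (d e) (edgeVec _ u) = 0` for `d`,
and the same with `dotForm` for `d^⊥`.

Necessity is a dimension count. If the equations of the edges in `F` are independent, their
solutions have dimension `2n - |F|`, while solutions can be chosen separately on the components of
`F`. Let `p` be a faithful realization. The dot system always admits the vertical translation; on a
component with trivial `ρ`-image it admits, after switching lifts, both translations and the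
quarter-turned `p`. The det system always admits the vertical translation and `p` itself, and on
trivial components also the horizontal translation. The dimensions 1, 3 and 2, 3 are the constants
of the two counts (`satisfiesCount_of_solutions`). Collapse of `d^⊥` makes all `2n - 1` dot
equations independent. Uniqueness for `d` gives the det system rank at least `2n - 2`, and `2n - 2`
independent edges form a Ross graph.

For sufficiency, directions are read off from the edges of a configuration `p`. Then `p` solves the
det system, and the dot rows form the symmetric rigidity matrix of `p`. Independence of rows at one
position implies independence at almost all positions on any line through it, so the conditions for
the two forms can be met together (`StressFree.exists_common`). Independence itself follows from
sparsity, for both forms at once, by a Henneberg induction on the double cover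
(`IsSparse.exists_stressFree`). Some vertex has degree at most three. If its degree is three and it
carries no loop, it can be replaced by an edge between two of its neighbors without losing sparsity:
uncrossing shows that tight sets cannot block all three pairs (`IsSparse.exists_update`).
Conversely, subdividing an edge at its midpoint and joining the new point to a third one preserves
independence. Loops occur only for the dot form with constant 1. -/

namespace ReflectionSparsity

/-! ### Sparsity on a double cover with an involution. -/

open Finset

variable {C E : Type*} [DecidableEq C]

/-- The edges of `A` with a translate (under the involution `τ`) inside `X`. -/
def edgesIn (τ : C → C) (ends : E → C × C) (A : Finset E) (X : Finset C) : Finset E :=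
  A.filter fun e => ((ends e).1 ∈ X ∧ (ends e).2 ∈ X) ∨ (τ (ends e).1 ∈ X ∧ τ (ends e).2 ∈ X)

/-- The saturation of a set of vertices under the involution `τ`. -/
def sat (τ : C → C) (X : Finset C) : Finset C := X ∪ X.image τ

/-- Sparsity on the covering graph: `ℓ` is the constant for invariant vertex sets. -/
structure IsSparse (τ : C → C) (ℓ : ℤ) (ends : E → C × C) (A : Finset E) : Prop where
  ends_ne : ∀ e ∈ A, (ends e).1 ≠ (ends e).2
  card_le_of_invariant : ∀ Z : Finset C, Z.Nonempty → (∀ c ∈ Z, τ c ∈ Z) →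
    ((edgesIn τ ends A Z).card : ℤ) ≤ Z.card - ℓ
  card_le_of_balanced : ∀ X : Finset C, (∀ c ∈ X, τ c ∉ X) → 2 ≤ X.card →
    ((edgesIn τ ends A X).card : ℤ) ≤ 2 * X.card - 3

variable {τ : C → C} {ends : E → C × C} {A H : Finset E} {ℓ : ℤ} {T : Finset C}

theorem mem_edgesIn {X : Finset C} {e : E} : e ∈ edgesIn τ ends A X ↔ e ∈ A ∧
    (((ends e).1 ∈ X ∧ (ends e).2 ∈ X) ∨ (τ (ends e).1 ∈ X ∧ τ (ends e).2 ∈ X)) := by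
  simp [edgesIn]

theorem edgesIn_subset (X : Finset C) : edgesIn τ ends A X ⊆ A := filter_subset _ _

theorem edgesIn_mono {X Y : Finset C} (h : X ⊆ Y) : edgesIn τ ends A X ⊆ edgesIn τ ends A Y := by
  intro e
  simp only [mem_edgesIn]
  rintro ⟨hA, h' | h'⟩
  · exact ⟨hA, Or.inl ⟨h h'.1, h h'.2⟩⟩
  · exact ⟨hA, Or.inr ⟨h h'.1, h h'.2⟩⟩

theorem IsSparse.mono (h : IsSparse τ ℓ ends A) (hH : H ⊆ A) : IsSparse τ ℓ ends H where
  ends_ne e he := h.ends_ne e (hH he)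
  card_le_of_invariant Z h1 h2 := by
    refine le_trans ?_ (h.card_le_of_invariant Z h1 h2)
    exact_mod_cast card_le_card (filter_subset_filter _ hH)
  card_le_of_balanced X h1 h2 := by
    refine le_trans ?_ (h.card_le_of_balanced X h1 h2)
    exact_mod_cast card_le_card (filter_subset_filter _ hH)

theorem mem_image_involution (hτ : Function.Involutive τ) {X : Finset C} {c : C} :
    c ∈ X.image τ ↔ τ c ∈ X := by
  simp only [mem_image]
  constructor
  · rintro ⟨a, ha, rfl⟩
    rwa [hτ a]
  · intro h
    exact ⟨τ c, h, hτ c⟩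

theorem mem_sat (hτ : Function.Involutive τ) {X : Finset C} {c : C} :
    c ∈ sat τ X ↔ c ∈ X ∨ τ c ∈ X := by
  simp [sat, mem_image_involution hτ]

theorem subset_sat (X : Finset C) : X ⊆ sat τ X := subset_union_left

theorem sat_invariant (hτ : Function.Involutive τ) (X : Finset C) : ∀ c ∈ sat τ X, τ c ∈ sat τ X := by
  intro c
  rw [mem_sat hτ, mem_sat hτ, hτ c]
  exact Or.symm

theorem card_sat (hτ : Function.Involutive τ) {X : Finset C} (hX : ∀ c ∈ X, τ c ∉ X) :
    (sat τ X).card = 2 * X.card := by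
  rw [sat, card_union_of_disjoint, card_image_of_injective _ hτ.injective]
  · ring
  · rw [disjoint_left]
    intro c hc hc'
    exact hX c hc ((mem_image_involution hτ).1 hc')

theorem inter_sat (hτ : Function.Involutive τ) {Z X : Finset C} (hZ : ∀ c ∈ Z, τ c ∈ Z) :
    Z ∩ sat τ X = sat τ (X ∩ Z) := by
  ext c
  have h : c ∈ Z ↔ τ c ∈ Z := ⟨hZ c, fun h => by simpa [hτ c] using hZ _ h⟩
  simp only [mem_inter, mem_sat hτ]
  tauto

theorem card_inter_sat (hτ : Function.Involutive τ) {Z X : Finset C} (hZ : ∀ c ∈ Z, τ c ∈ Z)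
    (hX : ∀ c ∈ X, τ c ∉ X) : (Z ∩ sat τ X).card = 2 * (X ∩ Z).card := by
  rw [inter_sat hτ hZ, card_sat hτ]
  intro c hc hc'
  exact hX c (mem_inter.1 hc).1 (mem_inter.1 hc').1

theorem IsSparse.edgesIn_eq_empty (hτ : Function.Involutive τ) (h : IsSparse τ ℓ ends A)
    {X : Finset C} (hX : X.card ≤ 1) : edgesIn τ ends A X = ∅ := by
  rw [eq_empty_iff_forall_notMem]
  intro e he
  rw [mem_edgesIn] at he
  rw [card_le_one] at hX
  rcases he with ⟨hA, h' | h'⟩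
  · exact h.ends_ne e hA (hX _ h'.1 _ h'.2)
  · exact h.ends_ne e hA (hτ.injective (hX _ h'.1 _ h'.2))

theorem edgesIn_image (hτ : Function.Involutive τ) (X : Finset C) :
    edgesIn τ ends A (X.image τ) = edgesIn τ ends A X := by
  ext e
  simp only [mem_edgesIn, mem_image_involution hτ, hτ (ends e).1, hτ (ends e).2]
  tauto

variable [DecidableEq E]

/-- An edge counted by both sets has a lift in `X` and a lift in `Y`. These lifts are equal or
exchanged by `τ`, which is why two intersections are needed. -/
theorem inter_edgesIn_subset (hτ : Function.Involutive τ) (X Y : Finset C) :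
    edgesIn τ ends A X ∩ edgesIn τ ends A Y ⊆
      edgesIn τ ends A (X ∩ Y) ∪ edgesIn τ ends A (X ∩ Y.image τ) := by
  intro e
  simp only [mem_inter, mem_union, mem_edgesIn, mem_image_involution hτ, hτ (ends e).1,
    hτ (ends e).2]
  tauto

theorem inter_edgesIn_subset_of_invariant (hτ : Function.Involutive τ) {Z : Finset C}
    (hZ : ∀ c ∈ Z, τ c ∈ Z) (X : Finset C) :
    edgesIn τ ends A Z ∩ edgesIn τ ends A X ⊆ edgesIn τ ends A (X ∩ Z) := by
  intro e
  have h1 : τ (ends e).1 ∈ Z ↔ (ends e).1 ∈ Z :=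
    ⟨fun h => by simpa [hτ _] using hZ _ h, hZ _⟩
  have h2 : τ (ends e).2 ∈ Z ↔ (ends e).2 ∈ Z :=
    ⟨fun h => by simpa [hτ _] using hZ _ h, hZ _⟩
  simp only [mem_inter, mem_edgesIn, h1, h2]
  tauto

theorem card_edgesIn_add_le {X Y U : Finset C} (h : X ∪ Y ⊆ U) :
    (edgesIn τ ends A X).card + (edgesIn τ ends A Y).card ≤
      (edgesIn τ ends A U).card + (edgesIn τ ends A X ∩ edgesIn τ ends A Y).card := by
  rw [← card_union_add_card_inter]
  gcongr
  exact union_subset (edgesIn_mono (subset_union_left.trans h))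
    (edgesIn_mono (subset_union_right.trans h))

/-! ### Uncrossing of tight sets. -/

/-- `H` is sparse, and no set containing `T` is tight. -/
structure IsSparseRel (τ : C → C) (ℓ : ℤ) (ends : E → C × C) (H : Finset E) (T : Finset C) : Prop
    extends IsSparse τ ℓ ends H where
  lt_of_invariant : ∀ Z : Finset C, (∀ c ∈ Z, τ c ∈ Z) → T ⊆ Z →
    ((edgesIn τ ends H Z).card : ℤ) + 1 ≤ Z.card - ℓ
  lt_of_balanced : ∀ X : Finset C, (∀ c ∈ X, τ c ∉ X) → T ⊆ X →
    ((edgesIn τ ends H X).card : ℤ) + 1 ≤ 2 * X.card - 3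

/-- Submodularity: the bound for `Z ∩ W` would force `Z ∪ W` to be tight, although it contains `T`.
The intersection must be nonempty because the bound `|Z| - ℓ` is not available for the empty set. -/
theorem IsSparseRel.not_tight_invariant_pair (h : IsSparseRel τ ℓ ends H T)
    {Z W : Finset C} (hZ : ∀ c ∈ Z, τ c ∈ Z) (hW : ∀ c ∈ W, τ c ∈ W)
    (hT : T ⊆ Z ∪ W) (hne : (Z ∩ W).Nonempty)
    (hZt : (Z.card : ℤ) - ℓ ≤ (edgesIn τ ends H Z).card)
    (hWt : (W.card : ℤ) - ℓ ≤ (edgesIn τ ends H W).card) : False := by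
  have h1 := card_edgesIn_add_le (τ := τ) (ends := ends) (A := H) (Subset.refl (Z ∪ W))
  have h2 : edgesIn τ ends H Z ∩ edgesIn τ ends H W ⊆ edgesIn τ ends H (Z ∩ W) := by
    intro e
    simp only [mem_inter, mem_edgesIn]
    rintro ⟨⟨a, b⟩, -, d⟩
    refine ⟨a, ?_⟩
    rcases b with b | b <;> rcases d with d | d
    · exact Or.inl ⟨⟨b.1, d.1⟩, b.2, d.2⟩
    · exact Or.inr ⟨⟨hZ _ b.1, d.1⟩, hZ _ b.2, d.2⟩
    · exact Or.inr ⟨⟨b.1, hW _ d.1⟩, b.2, hW _ d.2⟩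
    · exact Or.inr ⟨⟨b.1, d.1⟩, b.2, d.2⟩
  have h3 := card_le_card h2
  have h4 := h.card_le_of_invariant (Z ∩ W) hne (fun c hc =>
    mem_inter.2 ⟨hZ c (mem_inter.1 hc).1, hW c (mem_inter.1 hc).2⟩)
  have h5 := h.lt_of_invariant (Z ∪ W) (fun c hc => by
    rcases mem_union.1 hc with hc | hc
    · exact mem_union_left _ (hZ c hc)
    · exact mem_union_right _ (hW c hc)) hT
  have h6 := card_union_add_card_inter Z W
  omega

/-- The union is taken with the saturation of `X`, to keep it invariant. The count leaves at most
one common point of `X` and `Z`, and one point carries no edge. -/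
theorem IsSparseRel.inter_of_tight_invariant_balanced (hτ : Function.Involutive τ)
    (h : IsSparseRel τ ℓ ends H T)
    {Z X : Finset C} (hZ : ∀ c ∈ Z, τ c ∈ Z) (hX : ∀ c ∈ X, τ c ∉ X) (hT : T ⊆ Z ∪ X)
    (hZt : (Z.card : ℤ) - ℓ ≤ (edgesIn τ ends H Z).card)
    (hXt : 2 * (X.card : ℤ) - 3 ≤ (edgesIn τ ends H X).card) :
    edgesIn τ ends H Z ∩ edgesIn τ ends H X = ∅ := by
  have h1 := card_edgesIn_add_le (τ := τ) (ends := ends) (A := H)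
    (union_subset_union (Subset.refl Z) (subset_sat (τ := τ) X))
  have h2 := inter_edgesIn_subset_of_invariant (ends := ends) (A := H) hτ hZ X
  have h3 := card_le_card h2
  have h4 := h.lt_of_invariant (Z ∪ sat τ X) (fun c hc => by
    rcases mem_union.1 hc with hc | hc
    · exact mem_union_left _ (hZ c hc)
    · exact mem_union_right _ (sat_invariant hτ X c hc))
    (hT.trans (union_subset_union (Subset.refl Z) (subset_sat (τ := τ) X)))
  have h5 := card_union_add_card_inter Z (sat τ X)
  rw [card_inter_sat hτ hZ hX, card_sat hτ hX] at h5
  have h6 : (X ∩ Z).card ≤ 1 := by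
    by_contra hc
    have := h.card_le_of_balanced (X ∩ Z) (fun c hc hc' =>
      hX c (mem_inter.1 hc).1 (mem_inter.1 hc').1) (by omega)
    omega
  rw [h.edgesIn_eq_empty hτ h6] at h2
  exact subset_empty.1 h2

/-- Both `X ∩ Y` and `X ∩ τY` have at most one point, so neither carries an edge. If `X ∩ τY` is
empty, then `X ∪ Y` is balanced and the usual uncrossing applies; otherwise the union is saturated
and the invariant bound is used. -/
theorem IsSparseRel.inter_of_tight_balanced_pair (hτ : Function.Involutive τ)
    (hℓ : 1 ≤ ℓ) (h : IsSparseRel τ ℓ ends H T)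
    {X Y : Finset C} (hX : ∀ c ∈ X, τ c ∉ X) (hY : ∀ c ∈ Y, τ c ∉ Y) (hT : T ⊆ X ∪ Y)
    (hne : (X ∩ Y).Nonempty)
    (hXt : 2 * (X.card : ℤ) - 3 ≤ (edgesIn τ ends H X).card)
    (hYt : 2 * (Y.card : ℤ) - 3 ≤ (edgesIn τ ends H Y).card) :
    edgesIn τ ends H X ∩ edgesIn τ ends H Y = ∅ := by
  have hK : ∀ c ∈ X ∩ Y, τ c ∉ X ∩ Y := fun c hc hc' => hX c (mem_inter.1 hc).1 (mem_inter.1 hc').1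
  have hL : ∀ c ∈ X ∩ Y.image τ, τ c ∉ X ∩ Y.image τ :=
    fun c hc hc' => hX c (mem_inter.1 hc).1 (mem_inter.1 hc').1
  have hbK := h.card_le_of_balanced _ hK
  have hbL := h.card_le_of_balanced _ hL
  have hK0 := h.edgesIn_eq_empty hτ (X := X ∩ Y)
  have hL0 := h.edgesIn_eq_empty hτ (X := X ∩ Y.image τ)
  have h2 := inter_edgesIn_subset (ends := ends) (A := H) hτ X Y
  have h3 := (card_le_card h2).trans (card_union_le _ _)
  have hpos := card_pos.2 hne
  have key : (X ∩ Y).card ≤ 1 ∧ (X ∩ Y.image τ).card ≤ 1 := by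
    rcases eq_empty_or_nonempty (X ∩ Y.image τ) with hE | hE
    · refine ⟨?_, by simp [hE]⟩
      rw [hL0 (by simp [hE]), card_empty] at h3
      have hd : ∀ c ∈ X ∪ Y, τ c ∉ X ∪ Y := by
        intro c hc hc'
        have hE' : ∀ c, c ∈ X → τ c ∈ Y → False := fun c h1 h2 => by
          have : c ∈ X ∩ Y.image τ := mem_inter.2 ⟨h1, (mem_image_involution hτ).2 h2⟩
          simp [hE] at this
        rcases mem_union.1 hc with hc | hc <;> rcases mem_union.1 hc' with hc' | hc'
        · exact hX _ hc hc'
        · exact hE' _ hc hc'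
        · exact hE' _ hc' (by rwa [hτ c])
        · exact hY _ hc hc'
      have h1 := card_edgesIn_add_le (τ := τ) (ends := ends) (A := H) (Subset.refl (X ∪ Y))
      have h4 := h.lt_of_balanced _ hd hT
      have h5 := card_union_add_card_inter X Y
      by_contra hc
      have := hbK (by omega)
      omega
    · have hposL := card_pos.2 hE
      have hsub : X ∪ Y ⊆ sat τ X ∪ sat τ Y := union_subset_union (subset_sat X) (subset_sat Y)
      have h1 := card_edgesIn_add_le (τ := τ) (ends := ends) (A := H) hsub
      have h4 := h.lt_of_invariant (sat τ X ∪ sat τ Y) (fun c hc => by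
        rcases mem_union.1 hc with hc | hc
        · exact mem_union_left _ (sat_invariant hτ X c hc)
        · exact mem_union_right _ (sat_invariant hτ Y c hc)) (hT.trans hsub)
      have h5 := card_union_add_card_inter (sat τ X) (sat τ Y)
      rw [inter_comm (sat τ X), card_inter_sat hτ (sat_invariant hτ Y) hX, card_sat hτ hX,
        card_sat hτ hY] at h5
      have h6 : (X ∩ sat τ Y).card = (X ∩ Y).card + (X ∩ Y.image τ).card := by
        rw [sat, inter_union_distrib_left, card_union_of_disjoint]
        rw [disjoint_left]
        intro c hc hc'
        exact hY c (mem_inter.1 hc).2 ((mem_image_involution hτ).1 (mem_inter.1 hc').2)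
      -- When just one of the two intersections has a single point, the contradiction is by exactly
      -- `ℓ`; this is where `1 ≤ ℓ` is needed. When both do, nothing remains to be shown.
      by_cases hk : 2 ≤ (X ∩ Y).card
      · have h7 := hbK hk
        by_cases hl : 2 ≤ (X ∩ Y.image τ).card
        · have h8 := hbL hl
          omega
        · rw [hL0 (by omega), card_empty] at h3
          omega
      · rw [hK0 (by omega), card_empty] at h3
        by_cases hl : 2 ≤ (X ∩ Y.image τ).card
        · have h8 := hbL hl
          omega
        · omega
  rw [hK0 key.1, hL0 key.2, union_empty] at h2
  exact subset_empty.1 h2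

theorem card_edgesIn_add_add_le {X Y W U : Finset C} (h : X ∪ Y ∪ W ⊆ U)
    (hXY : edgesIn τ ends A X ∩ edgesIn τ ends A Y = ∅)
    (hXW : edgesIn τ ends A X ∩ edgesIn τ ends A W = ∅)
    (hYW : edgesIn τ ends A Y ∩ edgesIn τ ends A W = ∅) :
    (edgesIn τ ends A X).card + (edgesIn τ ends A Y).card + (edgesIn τ ends A W).card ≤
      (edgesIn τ ends A U).card := by
  rw [← card_union_of_disjoint (disjoint_iff_inter_eq_empty.2 hXY), ← card_union_of_disjoint]
  · refine card_le_card (union_subset (union_subset (edgesIn_mono ?_) (edgesIn_mono ?_))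
      (edgesIn_mono ?_))
    · exact (subset_union_left.trans subset_union_left).trans h
    · exact (subset_union_right.trans subset_union_left).trans h
    · exact subset_union_right.trans h
  · rw [disjoint_iff_inter_eq_empty, union_inter_distrib_right, hXW, hYW, union_empty]

/-- The size of the union of three sets with pairwise common points. -/
theorem card_union_three_add_le (X Y W S S' : Finset C) (hS : S ⊆ X ∩ Y) (hS' : S' ⊆ (X ∪ Y) ∩ W) :
    (X ∪ Y ∪ W).card + S.card + S'.card ≤ X.card + Y.card + W.card := by
  have h1 := card_union_add_card_inter X Y
  have h2 := card_union_add_card_inter (X ∪ Y) W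
  have h3 := card_le_card hS
  have h4 := card_le_card hS'
  omega

/-- The three edge sets are disjoint, so they add up inside the invariant union. The overlaps over
`b`, then over `a` and `c`, save `2 + 4` points, exactly the `3 + 3` of the two balanced bounds;
hence the union would be tight. -/
theorem IsSparseRel.not_tight_invariant_balanced_balanced (hτ : Function.Involutive τ)
    (hfix : ∀ c, τ c ≠ c) (hℓ : 1 ≤ ℓ) {a b c : C} (h : IsSparseRel τ ℓ ends H {a, b, c})
    {Z X Y : Finset C} (hZ : ∀ c ∈ Z, τ c ∈ Z) (hX : ∀ c ∈ X, τ c ∉ X) (hY : ∀ c ∈ Y, τ c ∉ Y)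
    (hac : a ≠ c) (haZ : a ∈ Z) (hbZ : b ∈ Z) (hbX : b ∈ X) (hcX : c ∈ X) (haY : a ∈ Y) (hcY : c ∈ Y)
    (hZt : (Z.card : ℤ) - ℓ ≤ (edgesIn τ ends H Z).card)
    (hXt : 2 * (X.card : ℤ) - 3 ≤ (edgesIn τ ends H X).card)
    (hYt : 2 * (Y.card : ℤ) - 3 ≤ (edgesIn τ ends H Y).card) : False := by
  have h1 := h.inter_of_tight_invariant_balanced hτ hZ hX
    (by simp [insert_subset_iff, haZ, hbZ, hcX]) hZt hXt
  have h2 := h.inter_of_tight_invariant_balanced hτ hZ hY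
    (by simp [insert_subset_iff, haZ, hbZ, hcY]) hZt hYt
  have h3 := h.inter_of_tight_balanced_pair hτ hℓ hX hY
    (by simp [insert_subset_iff, haY, hbX, hcX]) ⟨c, by simp [hcX, hcY]⟩ hXt hYt
  have hsub : Z ∪ X ∪ Y ⊆ Z ∪ sat τ X ∪ sat τ Y :=
    union_subset_union (union_subset_union (Subset.refl Z) (subset_sat X)) (subset_sat Y)
  have h4 := card_edgesIn_add_add_le hsub h1 h2 h3
  have h5 := h.lt_of_invariant (Z ∪ sat τ X ∪ sat τ Y) (fun c hc => by
    rcases mem_union.1 hc with hc | hc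
    · rcases mem_union.1 hc with hc | hc
      · exact mem_union_left _ (mem_union_left _ (hZ c hc))
      · exact mem_union_left _ (mem_union_right _ (sat_invariant hτ X c hc))
    · exact mem_union_right _ (sat_invariant hτ Y c hc)) (by
      refine Subset.trans ?_ hsub
      simp [insert_subset_iff, haZ, hbZ, hcX])
  have hca : τ c ≠ a := fun hh => hY c hcY (hh ▸ haY)
  have hac' : τ a ≠ c := fun hh => hY a haY (hh ▸ hcY)
  have hcc : τ a ≠ τ c := fun hh => hac (hτ.injective hh)
  have h6 := card_union_three_add_le Z (sat τ X) (sat τ Y) {b, τ b} {a, τ a, c, τ c}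
    (by simp [insert_subset_iff, mem_sat hτ, hτ b, hbX, hbZ, hZ b hbZ])
    (by simp [insert_subset_iff, mem_sat hτ, hτ a, hτ c, haZ, hZ a haZ, haY, hcY, hcX])
  rw [card_sat hτ hX, card_sat hτ hY, card_pair (hfix b).symm,
    card_insert_of_notMem (by simp [hac, (hfix a).symm, hca.symm]),
    card_insert_of_notMem (by simp [hac', hcc]), card_pair (hfix c).symm] at h6
  omega

/-- The point `z` is a second overlap between the saturations of `X` and `Y`, besides `b`. The
saturated union thus has at most `2(|X| + |Y| + |W|) - 8` points, and its strict bound is below the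
`2(|X| + |Y| + |W|) - 9` edges present. -/
theorem IsSparseRel.not_tight_balanced_triple_of_ne (hτ : Function.Involutive τ)
    (hfix : ∀ c, τ c ≠ c) (hℓ : 1 ≤ ℓ) {a b c : C} (h : IsSparseRel τ ℓ ends H {a, b, c})
    {X Y W : Finset C} (hX : ∀ c ∈ X, τ c ∉ X) (hY : ∀ c ∈ Y, τ c ∉ Y) (hW : ∀ c ∈ W, τ c ∉ W)
    (hac : a ≠ c) (haX : a ∈ X) (hbX : b ∈ X) (hbY : b ∈ Y) (hcY : c ∈ Y) (haW : a ∈ W) (hcW : c ∈ W)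
    (hXt : 2 * (X.card : ℤ) - 3 ≤ (edgesIn τ ends H X).card)
    (hYt : 2 * (Y.card : ℤ) - 3 ≤ (edgesIn τ ends H Y).card)
    (hWt : 2 * (W.card : ℤ) - 3 ≤ (edgesIn τ ends H W).card) {z : C} (hzX : z ∈ X) (hzY : τ z ∈ Y) :
    False := by
  have h1 := h.inter_of_tight_balanced_pair hτ hℓ hX hY
    (by simp [insert_subset_iff, haX, hbX, hcY]) ⟨b, by simp [hbX, hbY]⟩ hXt hYt
  have h2 := h.inter_of_tight_balanced_pair hτ hℓ hX hW
    (by simp [insert_subset_iff, haX, hbX, hcW]) ⟨a, by simp [haX, haW]⟩ hXt hWt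
  have h3 := h.inter_of_tight_balanced_pair hτ hℓ hY hW
    (by simp [insert_subset_iff, haW, hbY, hcY]) ⟨c, by simp [hcY, hcW]⟩ hYt hWt
  have hsub : X ∪ Y ∪ W ⊆ sat τ X ∪ sat τ Y ∪ sat τ W :=
    union_subset_union (union_subset_union (subset_sat X) (subset_sat Y)) (subset_sat W)
  have h4 := card_edgesIn_add_add_le hsub h1 h2 h3
  have h5 := h.lt_of_invariant (sat τ X ∪ sat τ Y ∪ sat τ W) (fun c hc => by
    rcases mem_union.1 hc with hc | hc
    · rcases mem_union.1 hc with hc | hc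
      · exact mem_union_left _ (mem_union_left _ (sat_invariant hτ X c hc))
      · exact mem_union_left _ (mem_union_right _ (sat_invariant hτ Y c hc))
    · exact mem_union_right _ (sat_invariant hτ W c hc)) (by
      refine Subset.trans ?_ hsub
      simp [insert_subset_iff, haX, hbX, hcY])
  have hca : τ c ≠ a := fun hh => hW c hcW (hh ▸ haW)
  have hac' : τ a ≠ c := fun hh => hW a haW (hh ▸ hcW)
  have hcc : τ a ≠ τ c := fun hh => hac (hτ.injective hh)
  have hbz : b ≠ z := fun hh => hY b hbY (hh ▸ hzY)
  have hbz1 : τ b ≠ z := fun hh => hX b hbX (hh ▸ hzX)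
  have hbz2 : b ≠ τ z := fun hh => hbz1 (by rw [hh, hτ z])
  have hbz3 : τ b ≠ τ z := fun hh => hbz (hτ.injective hh)
  have h6 := card_union_three_add_le (sat τ X) (sat τ Y) (sat τ W) {b, τ b, z, τ z} {a, τ a, c, τ c}
    (by simp [insert_subset_iff, mem_sat hτ, hτ b, hτ z, hbX, hbY, hzX, hzY])
    (by simp [insert_subset_iff, mem_sat hτ, hτ a, hτ c, haX, haW, hcY, hcW])
  rw [card_sat hτ hX, card_sat hτ hY, card_sat hτ hW,
    card_insert_of_notMem (by simp [hbz, hbz2, (hfix b).symm]),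
    card_insert_of_notMem (by simp [hbz1, hbz3]), card_pair (hfix z).symm,
    card_insert_of_notMem (by simp [hac, (hfix a).symm, hca.symm]),
    card_insert_of_notMem (by simp [hac', hcc]), card_pair (hfix c).symm] at h6
  omega

/-- Either some pair of the sets also meets after applying `τ` to one of them, which is the
preceding situation up to relabeling, or the union of all three is balanced and would be tight. -/
theorem IsSparseRel.not_tight_balanced_triple (hτ : Function.Involutive τ)
    (hfix : ∀ c, τ c ≠ c) (hℓ : 1 ≤ ℓ) {a b c : C} (h : IsSparseRel τ ℓ ends H {a, b, c})
    {X Y W : Finset C} (hX : ∀ c ∈ X, τ c ∉ X) (hY : ∀ c ∈ Y, τ c ∉ Y) (hW : ∀ c ∈ W, τ c ∉ W)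
    (hab : a ≠ b) (hac : a ≠ c) (hbc : b ≠ c)
    (haX : a ∈ X) (hbX : b ∈ X) (hbY : b ∈ Y) (hcY : c ∈ Y) (haW : a ∈ W) (hcW : c ∈ W)
    (hXt : 2 * (X.card : ℤ) - 3 ≤ (edgesIn τ ends H X).card)
    (hYt : 2 * (Y.card : ℤ) - 3 ≤ (edgesIn τ ends H Y).card)
    (hWt : 2 * (W.card : ℤ) - 3 ≤ (edgesIn τ ends H W).card) : False := by
  have hT1 : {a, b, c} = ({a, c, b} : Finset C) := by ext; simp; tauto
  have hT2 : {a, b, c} = ({b, a, c} : Finset C) := by ext; simp; tauto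
  by_cases hXY : ∃ z ∈ X, τ z ∈ Y
  · obtain ⟨z, hz1, hz2⟩ := hXY
    exact h.not_tight_balanced_triple_of_ne hτ hfix hℓ hX hY hW hac haX hbX hbY hcY haW hcW
      hXt hYt hWt hz1 hz2
  by_cases hYW : ∃ z ∈ W, τ z ∈ Y
  · obtain ⟨z, hz1, hz2⟩ := hYW
    exact (hT1 ▸ h : IsSparseRel τ ℓ ends H {a, c, b}).not_tight_balanced_triple_of_ne hτ hfix hℓ hW hY hX hab haW hcW hcY
      hbY haX hbX hWt hYt hXt hz1 hz2
  by_cases hXW : ∃ z ∈ X, τ z ∈ W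
  · obtain ⟨z, hz1, hz2⟩ := hXW
    exact (hT2 ▸ h : IsSparseRel τ ℓ ends H {b, a, c}).not_tight_balanced_triple_of_ne hτ hfix hℓ hX hW hY hbc hbX haX haW
      hcW hbY hcY hXt hWt hYt hz1 hz2
  push Not at hXY hYW hXW
  have h1 := h.inter_of_tight_balanced_pair hτ hℓ hX hY
    (by simp [insert_subset_iff, haX, hbX, hcY]) ⟨b, by simp [hbX, hbY]⟩ hXt hYt
  have h2 := h.inter_of_tight_balanced_pair hτ hℓ hX hW
    (by simp [insert_subset_iff, haX, hbX, hcW]) ⟨a, by simp [haX, haW]⟩ hXt hWt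
  have h3 := h.inter_of_tight_balanced_pair hτ hℓ hY hW
    (by simp [insert_subset_iff, haW, hbY, hcY]) ⟨c, by simp [hcY, hcW]⟩ hYt hWt
  have h4 := card_edgesIn_add_add_le (Subset.refl _) h1 h2 h3
  have h5 := h.lt_of_balanced (X ∪ Y ∪ W) (fun z hz hz' => by
    have e := hτ z
    have s1 := hXY (τ z)
    have s2 := hYW (τ z)
    have s3 := hXW (τ z)
    rw [e] at s1 s2 s3
    rcases mem_union.1 hz with hz | hz
    · rcases mem_union.1 hz with hz | hz <;> rcases mem_union.1 hz' with hz' | hz'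
      · exact (mem_union.1 hz').elim (hX z hz) (hXY z hz)
      · exact hXW z hz hz'
      · exact (mem_union.1 hz').elim (fun h => s1 h hz) (hY z hz)
      · exact s2 hz' hz
    · rcases mem_union.1 hz' with hz' | hz'
      · exact (mem_union.1 hz').elim (fun h => s3 h hz) (hYW z hz)
      · exact hW z hz hz') (by simp [insert_subset_iff, haX, hbX, hcY])
  have h6 := card_union_three_add_le X Y W {b} {a, c} (by simp [hbX, hbY])
    (by simp [insert_subset_iff, haX, haW, hcY, hcW])
  rw [card_singleton, card_pair hac] at h6
  omega

/-! ### Adding an edge between neighbors of a removed vertex. -/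

/-- A tight set through `a` and `b`, which prevents the addition of an edge from `a` to `b`. -/
def IsBlocked (τ : C → C) (ℓ : ℤ) (ends : E → C × C) (H : Finset E) (a b : C) : Prop :=
  (∃ Z : Finset C, (∀ c ∈ Z, τ c ∈ Z) ∧ a ∈ Z ∧ b ∈ Z ∧
    (Z.card : ℤ) - ℓ ≤ (edgesIn τ ends H Z).card) ∨
  (∃ X : Finset C, (∀ c ∈ X, τ c ∉ X) ∧ a ∈ X ∧ b ∈ X ∧
    2 * (X.card : ℤ) - 3 ≤ (edgesIn τ ends H X).card)

theorem IsSparseRel.not_isBlocked_triple (hτ : Function.Involutive τ)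
    (hfix : ∀ c, τ c ≠ c) (hℓ : 1 ≤ ℓ) {a b c : C} (h : IsSparseRel τ ℓ ends H {a, b, c})
    (hab : a ≠ b) (hac : a ≠ c) (hbc : b ≠ c)
    (h1 : IsBlocked τ ℓ ends H a b) (h2 : IsBlocked τ ℓ ends H b c)
    (h3 : IsBlocked τ ℓ ends H a c) : False := by
  have hT1 : {a, b, c} = ({b, c, a} : Finset C) := by ext; simp; tauto
  have hT2 : {a, b, c} = ({a, c, b} : Finset C) := by ext; simp; tauto
  rcases h1 with ⟨X, hX, haX, hbX, hXt⟩ | ⟨X, hX, haX, hbX, hXt⟩ <;>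
  rcases h2 with ⟨Y, hY, hbY, hcY, hYt⟩ | ⟨Y, hY, hbY, hcY, hYt⟩ <;>
  rcases h3 with ⟨W, hW, haW, hcW, hWt⟩ | ⟨W, hW, haW, hcW, hWt⟩
  · exact h.not_tight_invariant_pair hX hY (by simp [insert_subset_iff, haX, hbX, hcY])
      ⟨b, by simp [hbX, hbY]⟩ hXt hYt
  · exact h.not_tight_invariant_pair hX hY (by simp [insert_subset_iff, haX, hbX, hcY])
      ⟨b, by simp [hbX, hbY]⟩ hXt hYt
  · exact h.not_tight_invariant_pair hX hW (by simp [insert_subset_iff, haX, hbX, hcW])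
      ⟨a, by simp [haX, haW]⟩ hXt hWt
  · exact h.not_tight_invariant_balanced_balanced hτ hfix hℓ hX hY hW hac haX hbX hbY hcY haW hcW
      hXt hYt hWt
  · exact h.not_tight_invariant_pair hY hW (by simp [insert_subset_iff, haW, hbY, hcW])
      ⟨c, by simp [hcY, hcW]⟩ hYt hWt
  · exact (hT1 ▸ h : IsSparseRel τ ℓ ends H {b, c, a}).not_tight_invariant_balanced_balanced hτ hfix hℓ hY hW hX hab.symm
      hbY hcY hcW haW hbX haX hYt hWt hXt
  · exact (hT2 ▸ h : IsSparseRel τ ℓ ends H {a, c, b}).not_tight_invariant_balanced_balanced hτ hfix hℓ hW hY hX hab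
      haW hcW hcY hbY haX hbX hWt hYt hXt
  · exact h.not_tight_balanced_triple hτ hfix hℓ hX hY hW hab hac hbc haX hbX hbY hcY haW hcW
      hXt hYt hWt

/-- Unless `a`, `b` is blocked, an edge from `a` to `b` can be added to a sparse graph. -/
theorem IsSparse.update (hτ : Function.Involutive τ) (h : IsSparse τ ℓ ends H) {a b : C} (hab : a ≠ b)
    (hb : ¬ IsBlocked τ ℓ ends H a b) {e₀ : E} (he₀ : e₀ ∉ H) :
    IsSparse τ ℓ (Function.update ends e₀ (a, b)) (insert e₀ H) := by
  have hup : ∀ e ∈ H, Function.update ends e₀ (a, b) e = ends e := fun e he =>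
    Function.update_of_ne (ne_of_mem_of_not_mem he he₀) _ _
  have hsub : ∀ X : Finset C, edgesIn τ (Function.update ends e₀ (a, b)) (insert e₀ H) X ⊆
      insert e₀ (edgesIn τ ends H X) := by
    intro X e he
    obtain ⟨he1, he2⟩ := mem_edgesIn.1 he
    rcases mem_insert.1 he1 with rfl | he1
    · exact mem_insert_self _ _
    · rw [hup e he1] at he2
      exact mem_insert_of_mem (mem_edgesIn.2 ⟨he1, he2⟩)
  have hsub' : ∀ X : Finset C, e₀ ∉ edgesIn τ (Function.update ends e₀ (a, b)) (insert e₀ H) X →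
      edgesIn τ (Function.update ends e₀ (a, b)) (insert e₀ H) X ⊆ edgesIn τ ends H X := by
    intro X h0 e he
    rcases mem_insert.1 (hsub X he) with rfl | h1
    · exact absurd he h0
    · exact h1
  have hcard : ∀ X, (edgesIn τ (Function.update ends e₀ (a, b)) (insert e₀ H) X).card ≤
      (edgesIn τ ends H X).card + 1 := fun X => (card_le_card (hsub X)).trans (card_insert_le _ _)
  have hmem : ∀ X, e₀ ∈ edgesIn τ (Function.update ends e₀ (a, b)) (insert e₀ H) X →
      (a ∈ X ∧ b ∈ X) ∨ (τ a ∈ X ∧ τ b ∈ X) := by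
    intro X hX
    simpa using (mem_edgesIn.1 hX).2
  refine ⟨?_, ?_, ?_⟩
  · intro e he
    rcases mem_insert.1 he with rfl | he
    · simpa using hab
    · rw [hup e he]
      exact h.ends_ne e he
  · intro Z hne hZ
    have h1 := h.card_le_of_invariant Z hne hZ
    by_cases h0 : e₀ ∈ edgesIn τ (Function.update ends e₀ (a, b)) (insert e₀ H) Z
    · have h2 := hcard Z
      have h3 : a ∈ Z ∧ b ∈ Z := by
        rcases hmem Z h0 with h3 | h3
        · exact h3
        · exact ⟨by simpa [hτ a] using hZ _ h3.1, by simpa [hτ b] using hZ _ h3.2⟩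
      by_contra hc
      exact hb (Or.inl ⟨Z, hZ, h3.1, h3.2, by omega⟩)
    · have := card_le_card (hsub' Z h0)
      omega
  · intro X hX h2X
    have h1 := h.card_le_of_balanced X hX h2X
    by_cases h0 : e₀ ∈ edgesIn τ (Function.update ends e₀ (a, b)) (insert e₀ H) X
    · have h2 := hcard X
      by_contra hc
      rcases hmem X h0 with h3 | h3
      · exact hb (Or.inr ⟨X, hX, h3.1, h3.2, by omega⟩)
      -- Only the other lift of the new edge lies in `X`; the mirror image of `X` has the same edges
      -- and contains `a` and `b`.
      · refine hb (Or.inr ⟨X.image τ, ?_, (mem_image_involution hτ).2 h3.1,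
          (mem_image_involution hτ).2 h3.2, ?_⟩)
        · intro c hc hc'
          rw [mem_image_involution hτ] at hc hc'
          exact hX _ hc hc'
        · rw [edgesIn_image hτ, card_image_of_injective _ hτ.injective]
          omega
    · have := card_le_card (hsub' X h0)
      omega

/-- Removing three edges from `w` to `a`, `b`, `c` leaves room at `{a, b, c}`. -/
theorem IsSparse.isSparseRel (hτ : Function.Involutive τ) (hfix : ∀ c, τ c ≠ c)
    (h : IsSparse τ ℓ ends A) (hH : H ⊆ A) {w a b c : C}
    (hw : ∀ e ∈ H, (ends e).1 ≠ w ∧ (ends e).2 ≠ w ∧ (ends e).1 ≠ τ w ∧ (ends e).2 ≠ τ w)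
    {N : Finset E} (hNH : Disjoint N H) (hcard : N.card = 3)
    (hmem : ∀ X : Finset C, w ∈ X → a ∈ X → b ∈ X → c ∈ X → N ⊆ edgesIn τ ends A X)
    (ha : a ≠ w) (ha' : a ≠ τ w) (hb : b ≠ w) (hb' : b ≠ τ w) (hc : c ≠ w) (hc' : c ≠ τ w) :
    IsSparseRel τ ℓ ends H {a, b, c} := by
  -- Adding `w` raises the bound by 2 but brings 3 edges, so one unit of room remains in any set
  -- containing `a`, `b`, `c`.
  have key : ∀ X Y : Finset C, X ⊆ Y → w ∈ Y → {a, b, c} ⊆ X →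
      (edgesIn τ ends H X).card + 3 ≤ (edgesIn τ ends A Y).card := by
    intro X Y hXY hwY hT
    simp only [insert_subset_iff, singleton_subset_iff] at hT
    rw [← hcard, ← card_union_of_disjoint]
    · refine card_le_card (union_subset ?_
        (hmem Y hwY (hXY hT.1) (hXY hT.2.1) (hXY hT.2.2)))
      exact (edgesIn_mono hXY).trans (filter_subset_filter _ hH)
    · exact (hNH.mono_right (edgesIn_subset X)).symm
  refine ⟨h.mono hH, ?_, ?_⟩
  · intro Z hZ hT
    have h1 := key Z (insert w (insert (τ w) Z)) (by intro x; simp; tauto) (by simp) hT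
    have h2 := h.card_le_of_invariant (insert w (insert (τ w) Z)) ⟨w, by simp⟩ (by
      intro x hx
      simp only [mem_insert] at hx ⊢
      rcases hx with rfl | rfl | hx
      · simp
      · simp [hτ w]
      · exact Or.inr (Or.inr (hZ x hx)))
    have h3 := card_insert_le w (insert (τ w) Z)
    have h4 := card_insert_le (τ w) Z
    omega
  · intro X hX hT
    -- `X` may contain `τ w`, and then adding `w` would destroy balance. Removing both lifts first
    -- loses no edge of `H`.
    set X' := (X.erase w).erase (τ w) with hX'
    have hX'X : X' ⊆ X := (erase_subset _ _).trans (erase_subset _ _)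
    have hd : ∀ x ∈ insert w X', τ x ∉ insert w X' := by
      intro x hx hx'
      simp only [hX', mem_insert, mem_erase] at hx hx'
      rcases hx with rfl | hx
      · rcases hx' with hx' | hx'
        · exact hfix _ hx'
        · exact hx'.1 rfl
      · rcases hx' with hx' | hx'
        · exact hx.1 (by rw [← hx', hτ x])
        · exact hX x hx.2.2 hx'.2.2
    have hT' : {a, b, c} ⊆ X' := by
      simp only [insert_subset_iff, singleton_subset_iff] at hT ⊢
      simp [hX', hT, ha, ha', hb, hb', hc, hc']
    have h1 := key X' (insert w X') (subset_insert _ _) (mem_insert_self _ _) hT'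
    have hwX' : w ∉ X' := by simp [hX']
    have h0 : 0 < X'.card := card_pos.2 ⟨a, hT' (by simp)⟩
    have h2 := h.card_le_of_balanced (insert w X') hd (by
      rw [card_insert_of_notMem hwX']; omega)
    rw [card_insert_of_notMem hwX'] at h2
    have h3 : edgesIn τ ends H X ⊆ edgesIn τ ends H X' := by
      intro e he
      rw [mem_edgesIn] at he ⊢
      obtain ⟨n1, n2, n3, n4⟩ := hw e he.1
      have m1 : τ (ends e).1 ≠ w := fun hh => n3 (by rw [← hh, hτ])
      have m2 : τ (ends e).2 ≠ w := fun hh => n4 (by rw [← hh, hτ])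
      have m3 : τ (ends e).1 ≠ τ w := fun hh => n1 (hτ.injective hh)
      have m4 : τ (ends e).2 ≠ τ w := fun hh => n2 (hτ.injective hh)
      simp only [hX', mem_erase]
      tauto
    have h4 := card_le_card h3
    have h5 := card_le_card hX'X
    push_cast at h2
    omega

end ReflectionSparsity

namespace ReflectionSparsity

open Finset

/-! ### Generic positions -/

variable {V E : Type*}

/-- The involution exchanging the two lifts of a vertex. -/
def flipLift (c : V × ZMod 2) : V × ZMod 2 := (c.1, c.2 + 1)

theorem zmod_two_cases (s : ZMod 2) : s = 0 ∨ s = 1 := by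
  revert s; decide

theorem flipLift_involutive : Function.Involutive (flipLift (V := V)) := by
  rintro ⟨v, s⟩
  simp only [flipLift, Prod.mk.injEq, true_and]
  revert s; decide

theorem flipLift_ne (c : V × ZMod 2) : flipLift c ≠ c := by
  obtain ⟨v, s⟩ := c
  simp only [flipLift, ne_eq, Prod.mk.injEq, true_and]
  revert s; decide

theorem eq_or_eq_flip_of_fst_eq {c : V × ZMod 2} {v : V} (h : c.1 = v) (s : ZMod 2) :
    c = (v, s) ∨ c = flipLift (v, s) := by
  obtain ⟨w, t⟩ := c
  simp only at h
  subst h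
  simp only [flipLift, Prod.mk.injEq, true_and]
  revert s t; decide

/-- The sign of an element of `ℤ/2`. -/
def sgn (s : ZMod 2) : ℝ := if s = 0 then 1 else -1

@[simp] theorem sgn_zero : sgn 0 = 1 := by simp [sgn]

@[simp] theorem sgn_one : sgn 1 = -1 := by simp [sgn]

theorem sgn_add (s t : ZMod 2) : sgn (s + t) = sgn s * sgn t := by
  have h2 : (1 : ZMod 2) + 1 = 0 := by decide
  rcases zmod_two_cases s with rfl | rfl <;> rcases zmod_two_cases t with rfl | rfl <;>
    simp [h2]

theorem sgn_mul_self (s : ZMod 2) : sgn s * sgn s = 1 := by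
  rcases zmod_two_cases s with rfl | rfl <;> simp

theorem sgn_ne_zero (s : ZMod 2) : sgn s ≠ 0 := fun h => by
  simpa [h] using sgn_mul_self s

/-- The position of the vertex `c` of the cover, in terms of the positions of the vertices
with second coordinate `0`. -/
def lift (c : V × ZMod 2) : (V → ℝ × ℝ) →ₗ[ℝ] ℝ × ℝ where
  toFun p := (sgn c.2 * (p c.1).1, (p c.1).2)
  map_add' p q := by ext <;> simp [mul_add]
  map_smul' r p := by ext <;> simp [mul_left_comm]

@[simp] theorem lift_fst (c : V × ZMod 2) (p : V → ℝ × ℝ) : (lift c p).1 = sgn c.2 * (p c.1).1 := rfl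

@[simp] theorem lift_snd (c : V × ZMod 2) (p : V → ℝ × ℝ) : (lift c p).2 = (p c.1).2 := rfl

theorem lift_zero_color (v : V) (p : V → ℝ × ℝ) : lift (v, 0) p = p v := by
  ext <;> simp

theorem lift_congr {c : V × ZMod 2} {p q : V → ℝ × ℝ} (h : p c.1 = q c.1) : lift c p = lift c q := by
  ext <;> simp [h]

/-- The difference of the positions of the ends of an edge. -/
def edgeVec (e : (V × ZMod 2) × (V × ZMod 2)) : (V → ℝ × ℝ) →ₗ[ℝ] ℝ × ℝ := lift e.2 - lift e.1

theorem edgeVec_apply (e : (V × ZMod 2) × (V × ZMod 2)) (p : V → ℝ × ℝ) :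
    edgeVec e p = lift e.2 p - lift e.1 p := rfl

theorem edgeVec_congr {e : (V × ZMod 2) × (V × ZMod 2)} {p q : V → ℝ × ℝ}
    (h1 : p e.1.1 = q e.1.1) (h2 : p e.2.1 = q e.2.1) : edgeVec e p = edgeVec e q := by
  rw [edgeVec_apply, edgeVec_apply, lift_congr h1, lift_congr h2]

/-- A nondegenerate bilinear form on the plane, preserved by the reflection up to sign. -/
structure IsReflectionForm (B : ℝ × ℝ →ₗ[ℝ] ℝ × ℝ →ₗ[ℝ] ℝ) : Prop where
  eq_zero_of_forall : ∀ d, (∀ u, B d u = 0) → d = 0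
  reflect : ∃ ε : ℝ, ε ≠ 0 ∧ ∀ d u : ℝ × ℝ, B (-d.1, d.2) (-u.1, u.2) = ε * B d u

/-- The scalar product. -/
noncomputable def dotForm : ℝ × ℝ →ₗ[ℝ] ℝ × ℝ →ₗ[ℝ] ℝ :=
  LinearMap.mk₂ ℝ (fun d u => d.1 * u.1 + d.2 * u.2)
    (fun a b c => by simp; ring) (fun r a b => by simp; ring)
    (fun a b c => by simp; ring) (fun r a b => by simp; ring)

/-- The determinant. -/
noncomputable def detForm : ℝ × ℝ →ₗ[ℝ] ℝ × ℝ →ₗ[ℝ] ℝ :=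
  LinearMap.mk₂ ℝ (fun d u => d.1 * u.2 - d.2 * u.1)
    (fun a b c => by simp; ring) (fun r a b => by simp; ring)
    (fun a b c => by simp; ring) (fun r a b => by simp; ring)

@[simp] theorem dotForm_apply (d u : ℝ × ℝ) : dotForm d u = d.1 * u.1 + d.2 * u.2 := rfl

@[simp] theorem detForm_apply (d u : ℝ × ℝ) : detForm d u = d.1 * u.2 - d.2 * u.1 := rfl

theorem isReflectionForm_dotForm : IsReflectionForm dotForm where
  eq_zero_of_forall d h := by
    have h1 := h (1, 0)
    have h2 := h (0, 1)
    ext <;> simp_all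
  reflect := ⟨1, one_ne_zero, fun d u => by simp⟩

theorem isReflectionForm_detForm : IsReflectionForm detForm where
  eq_zero_of_forall d h := by
    have h1 := h (1, 0)
    have h2 := h (0, 1)
    ext <;> simp_all
  reflect := ⟨-1, by norm_num, fun d u => by simp; ring⟩

/-! ### Independence of edge rows as a generic property. -/

/-- The rows `u ↦ B (edgeVec e p) (edgeVec e u)`, for the edges `e` in `A`, are independent. -/
def StressFree (B : ℝ × ℝ →ₗ[ℝ] ℝ × ℝ →ₗ[ℝ] ℝ) (ends : E → (V × ZMod 2) × (V × ZMod 2))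
    (A : Finset E) (p : V → ℝ × ℝ) : Prop :=
  ∀ ω : E → ℝ, (∀ u, ∑ e ∈ A, ω e * B (edgeVec (ends e) p) (edgeVec (ends e) u) = 0) →
    ∀ e ∈ A, ω e = 0

variable {B : ℝ × ℝ →ₗ[ℝ] ℝ × ℝ →ₗ[ℝ] ℝ} {ends : E → (V × ZMod 2) × (V × ZMod 2)}
  {A H : Finset E} {p : V → ℝ × ℝ}

/-- The linear map whose components are the rows of the edges in `A`. -/
def rowMap (B : ℝ × ℝ →ₗ[ℝ] ℝ × ℝ →ₗ[ℝ] ℝ) (ends : E → (V × ZMod 2) × (V × ZMod 2))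
    (A : Finset E) (p : V → ℝ × ℝ) : (V → ℝ × ℝ) →ₗ[ℝ] (A → ℝ) :=
  LinearMap.pi fun e => B (edgeVec (ends e) p) ∘ₗ edgeVec (ends e)

@[simp] theorem rowMap_apply (u : V → ℝ × ℝ) (e : A) :
    rowMap B ends A p u e = B (edgeVec (ends e) p) (edgeVec (ends e) u) := rfl

/-- A nonzero functional vanishing on the range would be a nonzero stress. -/
theorem StressFree.rowMap_surjective (h : StressFree B ends A p) :
    Function.Surjective (rowMap B ends A p) := by
  classical
  rw [← LinearMap.range_eq_top]
  by_contra hne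
  obtain ⟨f, hf, hf'⟩ := Submodule.exists_le_ker_of_lt_top _ (lt_top_iff_ne_top.2 hne)
  apply hf
  have key : ∀ w : A → ℝ, f w = ∑ e : A, w e * f (Pi.single e 1) := by
    intro w
    conv_lhs => rw [← Finset.univ_sum_single w, map_sum]
    refine Finset.sum_congr rfl fun e _ => ?_
    rw [← smul_eq_mul, ← map_smul]
    congr 1
    ext e'
    rcases eq_or_ne e' e with rfl | h
    · simp
    · simp [h]
  have h0 := h (fun e => if he : e ∈ A then f (Pi.single ⟨e, he⟩ 1) else 0) (fun u => by
    have h1 : f (rowMap B ends A p u) = 0 := hf' (LinearMap.mem_range_self _ u)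
    rw [key] at h1
    rw [← Finset.sum_coe_sort]
    rw [← h1]
    refine Finset.sum_congr rfl fun e _ => ?_
    simp [mul_comm])
  ext e
  have := h0 e.1 e.2
  simpa using this

/-- Along a line through a stress-free position, almost all positions are stress-free. -/
theorem StressFree.finite_not (h : StressFree B ends A p) (q : V → ℝ × ℝ) :
    {t : ℝ | ¬ StressFree B ends A (p + t • q)}.Finite := by
  classical
  -- The `u e` are dual to the rows at `p`. Rows are linear in the position, so at `p + t • q` their
  -- values on the `u e` form `1 + t • N`, whose determinant is a polynomial with value 1 at `t =
  -- 0`.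
  choose u hu using fun e : A => h.rowMap_surjective (Pi.single e 1)
  let N : Matrix A A ℝ := fun e e' => B (edgeVec (ends e) q) (edgeVec (ends e) (u e'))
  let P : Polynomial ℝ := Matrix.det
    (Matrix.of fun e e' => Polynomial.C ((1 : Matrix A A ℝ) e e') + Polynomial.X * Polynomial.C (N e e'))
  have hM : ∀ t, P.eval t = Matrix.det ((1 : Matrix A A ℝ) + t • N) := by
    intro t
    rw [← Polynomial.coe_evalRingHom, RingHom.map_det]
    congr 1
    ext e e'
    simp [mul_comm t]
  have hP : P ≠ 0 := by
    intro hP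
    have := hM 0
    rw [hP, Polynomial.eval_zero, zero_smul, add_zero, Matrix.det_one] at this
    exact zero_ne_one this
  refine (Polynomial.finite_setOfPred_isRoot hP).subset ?_
  intro t ht
  by_contra hroot
  apply ht
  have hdet : Matrix.det ((1 : Matrix A A ℝ) + t • N) ≠ 0 := by rwa [← hM]
  intro ω hω e he
  have hv : Matrix.vecMul (fun e : A => ω e) ((1 : Matrix A A ℝ) + t • N) = 0 := by
    ext e'
    have h1 := hω (u e')
    rw [← Finset.sum_coe_sort] at h1
    rw [Pi.zero_apply, ← h1]
    refine Finset.sum_congr rfl fun e _ => ?_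
    have h2 := congrFun (hu e') e
    simp only [rowMap_apply] at h2
    simp only [Matrix.add_apply, map_add, map_smul, LinearMap.add_apply, h2,
      LinearMap.smul_apply, Matrix.one_apply, Pi.single_apply]
    rfl
  exact congrFun (Matrix.eq_zero_of_vecMul_eq_zero hdet hv) ⟨e, he⟩

theorem exists_notMem_of_finite {S T : Set ℝ} (hS : S.Finite) (hT : T.Finite) :
    ∃ t, t ∉ S ∧ t ∉ T := by
  obtain ⟨t, ht⟩ := (hS.union hT).exists_notMem
  exact ⟨t, fun h => ht (Or.inl h), fun h => ht (Or.inr h)⟩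

/-- Two independence conditions which hold at some position each hold simultaneously somewhere. -/
theorem StressFree.exists_common {F : Type*} {B' : ℝ × ℝ →ₗ[ℝ] ℝ × ℝ →ₗ[ℝ] ℝ}
    {ends' : F → (V × ZMod 2) × (V × ZMod 2)} {A' : Finset F} {q : V → ℝ × ℝ}
    (h : StressFree B ends A p) (h' : StressFree B' ends' A' q) :
    ∃ r, StressFree B ends A r ∧ StressFree B' ends' A' r := by
  have h1 := h.finite_not (q - p)
  have h2 := (h'.finite_not (p - q)).preimage (f := fun t : ℝ => 1 - t)
    (fun a _ b _ hab => by simpa using hab)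
  obtain ⟨t, ht1, ht2⟩ := exists_notMem_of_finite h1 h2
  refine ⟨p + t • (q - p), by simpa using ht1, ?_⟩
  have h3 : p + t • (q - p) = q + (1 - t) • (p - q) := by
    ext v <;> simp <;> ring
  rw [h3]
  simpa using ht2

/-- Twice the signed area of the triangle with vertices `a`, `b`, `c`. -/
def area (a b c : ℝ × ℝ) : ℝ := (b.1 - a.1) * (c.2 - a.2) - (b.2 - a.2) * (c.1 - a.1)

/-- Points on the parabola `y = x²`, which the reflection preserves: the area is a Vandermonde
product. Positive abscissas keep the two lifts of a vertex apart. -/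
theorem exists_area_ne_zero [Finite V] {a b c : V × ZMod 2} (hab : a ≠ b) (hac : a ≠ c)
    (hbc : b ≠ c) : ∃ p : V → ℝ × ℝ, area (lift a p) (lift b p) (lift c p) ≠ 0 := by
  obtain ⟨n, ⟨f⟩⟩ := Finite.exists_equiv_fin V
  let x : V → ℝ := fun v => (f v : ℕ) + 1
  have hx : ∀ v, 0 < x v := fun v => by positivity
  have hinj : ∀ {v w}, x v = x w → v = w := by
    intro v w h
    have : ((f v : ℕ) : ℝ) = (f w : ℕ) := by simpa [x] using h
    exact f.injective (Fin.ext (by exact_mod_cast this))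
  let p : V → ℝ × ℝ := fun v => (x v, x v ^ 2)
  have hs : ∀ {c d : V × ZMod 2}, c ≠ d → sgn d.2 * x d.1 - sgn c.2 * x c.1 ≠ 0 := by
    rintro ⟨v, s⟩ ⟨w, t⟩ hcd h
    have hv := hx v
    have hw := hx w
    simp only at h
    apply hcd
    rcases zmod_two_cases s with rfl | rfl <;> rcases zmod_two_cases t with rfl | rfl <;>
      simp only [sgn_zero, sgn_one] at h
    · rw [hinj (by linarith : x v = x w)]
    · linarith
    · linarith
    · rw [hinj (by linarith : x v = x w)]
  refine ⟨p, ?_⟩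
  have hsq : ∀ c : V × ZMod 2, (lift c p).2 = (lift c p).1 ^ 2 := by
    intro c
    have := sgn_mul_self c.2
    simp only [lift_snd, lift_fst, p, mul_pow]
    rw [pow_two (sgn c.2), this, one_mul]
  have harea : area (lift a p) (lift b p) (lift c p) =
      (sgn b.2 * x b.1 - sgn a.2 * x a.1) * (sgn c.2 * x c.1 - sgn a.2 * x a.1) *
        (sgn c.2 * x c.1 - sgn b.2 * x b.1) := by
    rw [area, hsq a, hsq b, hsq c]
    simp only [lift_fst, p]
    ring
  rw [harea]
  exact mul_ne_zero (mul_ne_zero (hs hab) (hs hac)) (hs hbc)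

/-- On the line from `p` to a position with nonzero area, the area is a polynomial in `t`; its zeros
and the positions with a stress are both finite in number. -/
theorem StressFree.exists_area_ne_zero [Finite V] (h : StressFree B ends A p) {a b c : V × ZMod 2}
    (hab : a ≠ b) (hac : a ≠ c) (hbc : b ≠ c) :
    ∃ q, StressFree B ends A q ∧ area (lift a q) (lift b q) (lift c q) ≠ 0 := by
  obtain ⟨p₁, hp₁⟩ := ReflectionSparsity.exists_area_ne_zero hab hac hbc
  have h1 := h.finite_not (p₁ - p)
  let L : ℝ → ℝ → Polynomial ℝ := fun r s => Polynomial.C r + Polynomial.X * Polynomial.C (s - r)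
  let P : Polynomial ℝ :=
    (L (lift b p).1 (lift b p₁).1 - L (lift a p).1 (lift a p₁).1) *
      (L (lift c p).2 (lift c p₁).2 - L (lift a p).2 (lift a p₁).2) -
    (L (lift b p).2 (lift b p₁).2 - L (lift a p).2 (lift a p₁).2) *
      (L (lift c p).1 (lift c p₁).1 - L (lift a p).1 (lift a p₁).1)
  have hL : ∀ t, P.eval t = area (lift a (p + t • (p₁ - p))) (lift b (p + t • (p₁ - p)))
      (lift c (p + t • (p₁ - p))) := by
    intro t
    simp only [P, L, area, map_add, map_smul, map_sub, Polynomial.eval_sub, Polynomial.eval_mul,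
      Polynomial.eval_add, Polynomial.eval_C, Polynomial.eval_X, Prod.fst_add, Prod.snd_add,
      Prod.smul_fst, Prod.smul_snd, Prod.fst_sub, Prod.snd_sub, smul_eq_mul]
  have hP : P ≠ 0 := by
    intro h0
    have := hL 1
    rw [h0] at this
    simp only [one_smul, add_sub_cancel, Polynomial.eval_zero] at this
    exact hp₁ this.symm
  obtain ⟨t, ht1, ht2⟩ := exists_notMem_of_finite h1 (Polynomial.finite_setOfPred_isRoot hP)
  refine ⟨_, by simpa using ht1, ?_⟩
  rw [← hL]
  exact ht2

theorem eq_zero_of_smul_add_smul {q a b : ℝ × ℝ} (h : area a b q ≠ 0) {r s : ℝ}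
    (hrs : r • (q - a) + s • (q - b) = 0) : r = 0 ∧ s = 0 := by
  have h1 := congrArg Prod.fst hrs
  have h2 := congrArg Prod.snd hrs
  simp only [Prod.fst_add, Prod.snd_add, Prod.smul_fst, Prod.smul_snd, Prod.fst_sub, Prod.snd_sub,
    smul_eq_mul, Prod.fst_zero, Prod.snd_zero] at h1 h2
  constructor
  · refine (mul_eq_zero.1 (?_ : r * area a b q = 0)).resolve_right h
    rw [area]
    linear_combination (q.2 - b.2) * h1 - (q.1 - b.1) * h2
  · refine (mul_eq_zero.1 (?_ : s * area a b q = 0)).resolve_right h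
    rw [area]
    linear_combination (q.1 - a.1) * h2 - (q.2 - a.2) * h1

end ReflectionSparsity

namespace ReflectionSparsity

open Finset

/-! ### Independent rows from sparsity -/

variable {V E : Type*} {B : ℝ × ℝ →ₗ[ℝ] ℝ × ℝ →ₗ[ℝ] ℝ} {ends : E → (V × ZMod 2) × (V × ZMod 2)}
  {A H N : Finset E} {p q : V → ℝ × ℝ} {v : V} {ℓ : ℤ}

theorem StressFree.congr (h : StressFree B ends H p)
    (hpq : ∀ e ∈ H, edgeVec (ends e) p = edgeVec (ends e) q) : StressFree B ends H q := by
  intro ω hω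
  refine h ω fun u => ?_
  rw [← hω u]
  exact sum_congr rfl fun e he => by rw [hpq e he]

theorem StressFree.congr_of_eq_off (h : StressFree B ends H p)
    (hH : ∀ e ∈ H, (ends e).1.1 ≠ v ∧ (ends e).2.1 ≠ v) (hpq : ∀ w, w ≠ v → p w = q w) :
    StressFree B ends H q :=
  h.congr fun e he => edgeVec_congr (hpq _ (hH e he).1) (hpq _ (hH e he).2)

theorem lift_single_of_ne [DecidableEq V] {a : V × ZMod 2} (ha : a.1 ≠ v) (w : ℝ × ℝ) :
    lift a (Pi.single v w) = 0 := by
  rw [lift_congr (q := 0) (by simp [Pi.single_eq_of_ne ha]), map_zero]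

theorem edgeVec_single_of_ne [DecidableEq V] {f : (V × ZMod 2) × (V × ZMod 2)}
    (hf : f.1.1 ≠ v ∧ f.2.1 ≠ v) (w : ℝ × ℝ) : edgeVec f (Pi.single v w) = 0 := by
  rw [edgeVec_apply, lift_single_of_ne hf.1, lift_single_of_ne hf.2, sub_zero]

/-- The system is block triangular: displacements of `v` alone do not see `H`, so the coefficients
on `N` vanish, and what is left is a stress of `H`. -/
theorem StressFree.union_of_local [DecidableEq V] [DecidableEq E] (h : StressFree B ends H p)
    (hH : ∀ e ∈ H, (ends e).1.1 ≠ v ∧ (ends e).2.1 ≠ v) (hNH : Disjoint N H)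
    (hN : ∀ ω : E → ℝ, (∀ w : ℝ × ℝ,
      ∑ e ∈ N, ω e * B (edgeVec (ends e) p) (edgeVec (ends e) (Pi.single v w)) = 0) →
      ∀ e ∈ N, ω e = 0) :
    StressFree B ends (N ∪ H) p := by
  intro ω hω
  have h1 : ∀ e ∈ N, ω e = 0 := by
    refine hN ω fun w => ?_
    have := hω (Pi.single v w)
    rw [sum_union hNH, sum_eq_zero (s := H), add_zero] at this
    · exact this
    · intro e he
      rw [edgeVec_single_of_ne (hH e he), map_zero, mul_zero]
  have h2 : ∀ e ∈ H, ω e = 0 := by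
    refine h ω fun u => ?_
    have := hω u
    rwa [sum_union hNH, sum_eq_zero (s := N), zero_add] at this
    intro e he
    rw [h1 e he, zero_mul]
  intro e he
  rcases mem_union.1 he with he | he
  · exact h1 e he
  · exact h2 e he

/-- Up to the involution, the edge with ends `f` joins `(v, 0)` to `a`, which does not lie over
`v`; and the row of `f` is a multiple of the corresponding row. -/
structure IsHalfEdge (B : ℝ × ℝ →ₗ[ℝ] ℝ × ℝ →ₗ[ℝ] ℝ) (f : (V × ZMod 2) × (V × ZMod 2)) (v : V)
    (a : V × ZMod 2) : Prop where
  fst_ne : a.1 ≠ v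
  mem : ∀ X : Finset (V × ZMod 2), (v, 0) ∈ X → a ∈ X →
    (f.1 ∈ X ∧ f.2 ∈ X) ∨ (flipLift f.1 ∈ X ∧ flipLift f.2 ∈ X)
  row : ∃ ε : ℝ, ε ≠ 0 ∧ ∀ p u : V → ℝ × ℝ,
    B (edgeVec f p) (edgeVec f u) = ε * B (p v - lift a p) (u v - lift a u)

theorem lift_flip (c : V × ZMod 2) (p : V → ℝ × ℝ) :
    lift (flipLift c) p = (-(lift c p).1, (lift c p).2) := by
  ext <;> simp [flipLift, sgn_add]

/-- If the end over `v` is `(v, 1)`, the edge is replaced by its mirror image, which changes the row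
only by the factor `ε` of the form. -/
theorem exists_isHalfEdge_of_fst (hB : IsReflectionForm B) {f : (V × ZMod 2) × (V × ZMod 2)}
    (h1 : f.1.1 = v) (h2 : f.2.1 ≠ v) : ∃ a, IsHalfEdge B f v a := by
  obtain ⟨c, d⟩ := f
  simp only at h1 h2
  rcases eq_or_eq_flip_of_fst_eq h1 0 with rfl | rfl
  · refine ⟨d, h2, fun X hX hd => Or.inl ⟨hX, hd⟩, 1, one_ne_zero, fun p u => ?_⟩
    simp only [edgeVec_apply, lift_zero_color]
    rw [← neg_sub (p v), ← neg_sub (u v), map_neg, map_neg, LinearMap.neg_apply, neg_neg, one_mul]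
  · refine ⟨flipLift d, h2, fun X hX hd => Or.inr ⟨by simpa [flipLift_involutive _] using hX, hd⟩, ?_⟩
    obtain ⟨ε, hε, h⟩ := hB.reflect
    refine ⟨ε, hε, fun p u => ?_⟩
    rw [← h]
    simp only [edgeVec_apply, lift_flip, lift_zero_color]
    have hneg : ∀ x y : ℝ × ℝ, B x y = B (-x) (-y) := fun x y => by simp
    rw [hneg]
    congr 1
    · congr 1
      ext <;> simp
      ring
    · ext <;> simp
      ring

theorem exists_isHalfEdge (hB : IsReflectionForm B) {f : (V × ZMod 2) × (V × ZMod 2)}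
    (h : f.1.1 = v ∨ f.2.1 = v) (h' : ¬ (f.1.1 = v ∧ f.2.1 = v)) : ∃ a, IsHalfEdge B f v a := by
  by_cases h1 : f.1.1 = v
  · exact exists_isHalfEdge_of_fst hB h1 fun h2 => h' ⟨h1, h2⟩
  · obtain ⟨a, ha⟩ := exists_isHalfEdge_of_fst (f := f.swap) hB (h.resolve_left h1) h1
    refine ⟨a, ha.fst_ne, fun X h0 h2 => ?_, ?_⟩
    · have := ha.mem X h0 h2
      simp only [Prod.fst_swap, Prod.snd_swap] at this
      tauto
    · obtain ⟨ε, hε, h⟩ := ha.row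
      refine ⟨ε, hε, fun p u => ?_⟩
      rw [← h]
      have hs : ∀ p, edgeVec f p = - edgeVec f.swap p := fun p => by simp [edgeVec_apply]
      rw [hs p, hs u]
      simp

theorem IsHalfEdge.row_single [DecidableEq V] {f : (V × ZMod 2) × (V × ZMod 2)} {a : V × ZMod 2}
    (h : IsHalfEdge B f v a) : ∃ ε : ℝ, ε ≠ 0 ∧ ∀ (p : V → ℝ × ℝ) (w : ℝ × ℝ),
      B (edgeVec f p) (edgeVec f (Pi.single v w)) = ε * B (p v - lift a p) w := by
  obtain ⟨ε, hε, hrow⟩ := h.row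
  refine ⟨ε, hε, fun p w => ?_⟩
  rw [hrow, Pi.single_eq_same, lift_single_of_ne h.fst_ne, sub_zero]

theorem IsHalfEdge.ne {f : (V × ZMod 2) × (V × ZMod 2)} {a : V × ZMod 2}
    (h : IsHalfEdge B f v a) (s : ZMod 2) : a ≠ (v, s) := fun hh => h.fst_ne (by rw [hh])

/-! ### Henneberg moves. -/

section Extension

variable [Finite V] [DecidableEq V] [DecidableEq E]

theorem exists_stressFree_of_one_edge (hB : IsReflectionForm B) (h : StressFree B ends H p)
    (hH : ∀ e ∈ H, (ends e).1.1 ≠ v ∧ (ends e).2.1 ≠ v) {e₁ : E} (he₁ : e₁ ∉ H) {a : V × ZMod 2}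
    (ha : IsHalfEdge B (ends e₁) v a) : ∃ q, StressFree B ends ({e₁} ∪ H) q := by
  -- `flipLift a` only serves as a third point; what matters is that `v` and `a` become distinct.
  obtain ⟨q, hq, harea⟩ := h.exists_area_ne_zero (flipLift_ne a).symm (ha.ne 0)
    (fun hh => ha.fst_ne (congrArg Prod.fst hh : (flipLift a).1 = v))
  refine ⟨q, hq.union_of_local hH (by simpa using he₁) fun ω hω e he => ?_⟩
  rw [mem_singleton] at he
  subst he
  obtain ⟨ε, hε, hrow⟩ := ha.row_single
  have h1 := hB.eq_zero_of_forall ((ω e * ε) • (q v - lift a q)) fun w => by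
    have := hω w
    rw [sum_singleton, hrow] at this
    rw [map_smul, LinearMap.smul_apply, smul_eq_mul, ← this]
    ring
  rw [lift_zero_color] at harea
  have h2 := (eq_zero_of_smul_add_smul (s := 0) harea (by rw [h1]; simp)).1
  exact (mul_eq_zero.1 h2).resolve_right hε

theorem exists_stressFree_of_two_edges (hB : IsReflectionForm B) (h : StressFree B ends H p)
    (hH : ∀ e ∈ H, (ends e).1.1 ≠ v ∧ (ends e).2.1 ≠ v) {e₁ e₂ : E} (he : e₁ ≠ e₂) (he₁ : e₁ ∉ H)
    (he₂ : e₂ ∉ H) {a b : V × ZMod 2} (ha : IsHalfEdge B (ends e₁) v a)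
    (hb : IsHalfEdge B (ends e₂) v b) (hab : a ≠ b) :
    ∃ q, StressFree B ends ({e₁, e₂} ∪ H) q := by
  obtain ⟨q, hq, harea⟩ := h.exists_area_ne_zero hab (ha.ne 0) (hb.ne 0)
  refine ⟨q, hq.union_of_local hH (by simp [he₁, he₂]) fun ω hω => ?_⟩
  obtain ⟨ε₁, hε₁, hrow₁⟩ := ha.row_single
  obtain ⟨ε₂, hε₂, hrow₂⟩ := hb.row_single
  have h1 := hB.eq_zero_of_forall ((ω e₁ * ε₁) • (q v - lift a q) + (ω e₂ * ε₂) • (q v - lift b q))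
    fun w => by
      have := hω w
      rw [sum_pair he, hrow₁, hrow₂] at this
      simp only [map_add, map_smul, LinearMap.add_apply, LinearMap.smul_apply, smul_eq_mul]
      rw [← this]
      ring
  rw [lift_zero_color] at harea
  obtain ⟨h2, h3⟩ := eq_zero_of_smul_add_smul harea h1
  intro e he
  rcases mem_insert.1 he with rfl | he
  · exact (mul_eq_zero.1 h2).resolve_right hε₁
  · rw [mem_singleton.1 he]
    exact (mul_eq_zero.1 h3).resolve_right hε₂

/-- The `1`-extension: an edge from `a` to `b` is subdivided, and the new vertex joined to `c`. -/
theorem exists_stressFree_of_three_edges (hB : IsReflectionForm B)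
    (hH : ∀ e ∈ H, (ends e).1.1 ≠ v ∧ (ends e).2.1 ≠ v) {e₁ e₂ e₃ : E} (h12 : e₁ ≠ e₂) (h13 : e₁ ≠ e₃)
    (h23 : e₂ ≠ e₃) (he₁ : e₁ ∉ H) (he₂ : e₂ ∉ H) (he₃ : e₃ ∉ H) {a b c : V × ZMod 2}
    (ha : IsHalfEdge B (ends e₁) v a) (hb : IsHalfEdge B (ends e₂) v b)
    (hc : IsHalfEdge B (ends e₃) v c) (hab : a ≠ b) (hac : a ≠ c) (hbc : b ≠ c)
    (h : StressFree B (Function.update ends e₁ (a, b)) (insert e₁ H) p) :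
    ∃ q, StressFree B ends ({e₁, e₂, e₃} ∪ H) q := by
  obtain ⟨p, hp, harea⟩ := h.exists_area_ne_zero hab hac hbc
  -- With `v` on the segment from `a` to `b`, both halves are parallel to it, so balance at `v`
  -- forces the edge to `c` to carry no stress and the halves to carry equal stress.
  set m : ℝ × ℝ := (1 / 2 : ℝ) • (lift a p + lift b p) with hm
  set q := Function.update p v m with hq
  have hqv : q v = m := by simp [hq]
  have hqne : ∀ w, w ≠ v → p w = q w := fun w hw => by simp [hq, hw]
  have hla : lift a q = lift a p := (lift_congr (hqne _ ha.fst_ne)).symm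
  have hlb : lift b q = lift b p := (lift_congr (hqne _ hb.fst_ne)).symm
  have hlc : lift c q = lift c p := (lift_congr (hqne _ hc.fst_ne)).symm
  have hqH : ∀ e ∈ H, edgeVec (ends e) q = edgeVec (ends e) p := fun e he =>
    (edgeVec_congr (hqne _ (hH e he).1) (hqne _ (hH e he).2)).symm
  have hN : Disjoint ({e₁, e₂, e₃} : Finset E) H := by simp [he₁, he₂, he₃]
  have hupd : ∀ e ∈ H, Function.update ends e₁ (a, b) e = ends e := fun e he =>
    Function.update_of_ne (ne_of_mem_of_not_mem he he₁) _ _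
  obtain ⟨ε₁, hε₁, hrow₁⟩ := ha.row
  obtain ⟨ε₂, hε₂, hrow₂⟩ := hb.row
  obtain ⟨ε₃, hε₃, hrow₃⟩ := hc.row
  have hma : m - lift a p = (1 / 2 : ℝ) • (lift b p - lift a p) := by
    rw [hm]; module
  have hmb : m - lift b p = (-(1 / 2) : ℝ) • (lift b p - lift a p) := by
    rw [hm]; module
  refine ⟨q, fun ω hω => ?_⟩
  have hsum : ∀ u, ω e₁ * ε₁ * B (m - lift a p) (u v - lift a u) +
      (ω e₂ * ε₂ * B (m - lift b p) (u v - lift b u) +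
        ω e₃ * ε₃ * B (m - lift c p) (u v - lift c u)) +
      ∑ e ∈ H, ω e * B (edgeVec (ends e) p) (edgeVec (ends e) u) = 0 := by
    intro u
    rw [← hω u, sum_union hN, sum_insert (by simp [h12, h13]), sum_pair h23, hrow₁, hrow₂, hrow₃, hqv,
      hla, hlb, hlc, sum_congr rfl fun e he => by rw [← hqH e he]]
    ring
  have hloc := hB.eq_zero_of_forall ((ω e₁ * ε₁) • (m - lift a p) + ((ω e₂ * ε₂) • (m - lift b p) +
      (ω e₃ * ε₃) • (m - lift c p))) fun w => by
    have := hsum (Pi.single v w)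
    rw [Pi.single_eq_same, lift_single_of_ne ha.fst_ne, lift_single_of_ne hb.fst_ne,
      lift_single_of_ne hc.fst_ne, sum_eq_zero fun e he => by
        rw [edgeVec_single_of_ne (hH e he), map_zero, mul_zero], add_zero, sub_zero] at this
    simpa only [map_add, map_smul, LinearMap.add_apply, LinearMap.smul_apply, smul_eq_mul] using this
  have hω₃ : ω e₃ * ε₃ = 0 ∧ ω e₁ * ε₁ = ω e₂ * ε₂ := by
    have harea' : area (lift a p) m (lift c p) ≠ 0 := by
      intro h0
      apply harea
      have : area (lift a p) m (lift c p) = (1 / 2) * area (lift a p) (lift b p) (lift c p) := by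
        simp only [area, hm, Prod.smul_fst, Prod.smul_snd, Prod.fst_add, Prod.snd_add, smul_eq_mul]
        ring
      rw [this] at h0
      simpa using h0
    have h1 : (ω e₁ * ε₁ - ω e₂ * ε₂) • (lift c p - lift a p) +
        (-(ω e₁ * ε₁ - ω e₂ * ε₂) - ω e₃ * ε₃) • (lift c p - m) = 0 := by
      rw [← hloc, hmb, ← neg_sub m (lift c p), ← sub_sub_sub_cancel_left (lift a p) (lift c p) m, hma]
      module
    obtain ⟨h2, h3⟩ := eq_zero_of_smul_add_smul harea' h1
    constructor <;> linarith
  have hω₃' : ω e₃ = 0 := (mul_eq_zero.1 hω₃.1).resolve_right hε₃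
  -- In the sum of the two half rows the displacement of `v` cancels, leaving half of the row of the
  -- edge from `a` to `b`; hence the factor `1/2`.
  have hstress := hp (Function.update ω e₁ (ω e₁ * ε₁ / 2)) fun u => by
    rw [sum_insert he₁, sum_congr rfl fun e he => by
      rw [hupd e he, Function.update_of_ne (ne_of_mem_of_not_mem he he₁)]]
    rw [Function.update_self, Function.update_self, ← hsum u, hω₃.1, ← hω₃.2, hma, hmb]
    simp only [edgeVec_apply, map_smul, LinearMap.smul_apply, smul_eq_mul, map_sub]
    ring
  have hω₁ : ω e₁ = 0 := by
    have := hstress e₁ (mem_insert_self _ _)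
    rw [Function.update_self] at this
    refine (mul_eq_zero.1 (?_ : ω e₁ * ε₁ = 0)).resolve_right hε₁
    linarith
  have hω₂ : ω e₂ = 0 := by
    have := hω₃.2
    rw [hω₁, zero_mul] at this
    exact (mul_eq_zero.1 this.symm).resolve_right hε₂
  intro e he
  simp only [mem_union, mem_insert, mem_singleton] at he
  rcases he with (rfl | rfl | rfl) | he
  · exact hω₁
  · exact hω₂
  · exact hω₃'
  · have := hstress e (mem_insert_of_mem he)
    rwa [Function.update_of_ne (ne_of_mem_of_not_mem he he₁)] at this

-- Such a loop joins a point to its mirror image, so its vector is horizontal and twice the abscissa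
-- up to sign.
omit [Finite V] [DecidableEq V] [DecidableEq E] in
theorem dotForm_loop {f : (V × ZMod 2) × (V × ZMod 2)} (hf : f.1 ≠ f.2) (h1 : f.1.1 = v)
    (h2 : f.2.1 = v) (p u : V → ℝ × ℝ) :
    dotForm (edgeVec f p) (edgeVec f u) = 4 * ((p v).1 * (u v).1) := by
  obtain ⟨⟨a, s⟩, b, t⟩ := f
  simp only at h1 h2
  subst h1 h2
  have hst : sgn t = - sgn s := by
    rcases zmod_two_cases s with rfl | rfl <;> rcases zmod_two_cases t with rfl | rfl <;>
      first | exact absurd rfl hf | simp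
  have := sgn_mul_self s
  simp only [edgeVec_apply, dotForm_apply, Prod.fst_sub, Prod.snd_sub, lift_fst, lift_snd, hst,
    sub_self, mul_zero, add_zero]
  linear_combination (4 * ((p b).1 * (u b).1)) * this

omit [Finite V] in
theorem exists_stressFree_of_loop (h : StressFree dotForm ends H p)
    (hH : ∀ e ∈ H, (ends e).1.1 ≠ v ∧ (ends e).2.1 ≠ v) {e₀ : E} (he₀ : e₀ ∉ H)
    (hne : (ends e₀).1 ≠ (ends e₀).2) (h1 : (ends e₀).1.1 = v) (h2 : (ends e₀).2.1 = v) :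
    ∃ q, StressFree dotForm ends ({e₀} ∪ H) q := by
  -- Any point off the axis would do: there the row of the loop is nonzero.
  refine ⟨_, (h.congr_of_eq_off (q := Function.update p v (1, 0)) hH
    (fun w hw => by simp [hw])).union_of_local hH (by simpa using he₀) fun ω hω e he => ?_⟩
  rw [mem_singleton] at he
  subst he
  have := hω (1, 0)
  rw [sum_singleton, dotForm_loop hne h1 h2] at this
  simpa using this

omit [Finite V] in
theorem exists_stressFree_of_loop_edge (h : StressFree dotForm ends H p)
    (hH : ∀ e ∈ H, (ends e).1.1 ≠ v ∧ (ends e).2.1 ≠ v) {e₀ e₁ : E} (he : e₀ ≠ e₁) (he₀ : e₀ ∉ H)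
    (he₁ : e₁ ∉ H) (hne : (ends e₀).1 ≠ (ends e₀).2) (h1 : (ends e₀).1.1 = v)
    (h2 : (ends e₀).2.1 = v) {a : V × ZMod 2} (ha : IsHalfEdge dotForm (ends e₁) v a) :
    ∃ q, StressFree dotForm ends ({e₀, e₁} ∪ H) q := by
  -- Off the axis the loop sees exactly horizontal displacements of `v`; at a height different from
  -- that of `a` the other edge also sees vertical ones.
  refine ⟨_, (h.congr_of_eq_off (q := Function.update p v (1, (lift a p).2 + 1)) hH
    (fun w hw => by simp [hw])).union_of_local hH (by simp [he₀, he₁]) fun ω hω => ?_⟩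
  obtain ⟨ε, hε, hrow⟩ := ha.row_single
  have h3 : lift a (Function.update p v (1, (lift a p).2 + 1)) = lift a p :=
    lift_congr (by simp [ha.fst_ne])
  have hω' : ∀ w : ℝ × ℝ, _ := fun w => hω w
  simp only [sum_pair he, dotForm_loop hne h1 h2, hrow, h3] at hω'
  have h4 := hω' (0, 1)
  simp [hε] at h4
  have h5 := hω' (1, 0)
  simp [h4] at h5
  simp [h4, h5]

end Extension

end ReflectionSparsity

namespace ReflectionSparsity

open Finset

variable {V E : Type*} {B : ℝ × ℝ →ₗ[ℝ] ℝ × ℝ →ₗ[ℝ] ℝ} {ends : E → (V × ZMod 2) × (V × ZMod 2)}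
  {A H N : Finset E} {v : V} {ℓ : ℤ}

/-! ### Induction on sparse graphs by removing a vertex. -/

section Henneberg

variable [DecidableEq V]

/-- With loops counted twice, the degrees over the used vertices `W` sum to `2|A| ≤ 4|W| - 2ℓ <
4|W|`. -/
theorem IsSparse.exists_degree_le_three (h : IsSparse flipLift ℓ ends A) (hℓ : 1 ≤ ℓ)
    (hA : A.Nonempty) : ∃ v,
      0 < (A.filter fun e => (ends e).1.1 = v).card + (A.filter fun e => (ends e).2.1 = v).card ∧
      (A.filter fun e => (ends e).1.1 = v).card + (A.filter fun e => (ends e).2.1 = v).card ≤ 3 := by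
  set W : Finset V := A.image (fun e => (ends e).1.1) ∪ A.image (fun e => (ends e).2.1) with hW
  have h1 : ∀ e ∈ A, (ends e).1.1 ∈ W := fun e he =>
    mem_union_left _ (mem_image_of_mem _ he)
  have h2 : ∀ e ∈ A, (ends e).2.1 ∈ W := fun e he =>
    mem_union_right _ (mem_image_of_mem (fun e => (ends e).2.1) he)
  have hs : ((∑ v ∈ W, ((A.filter fun e => (ends e).1.1 = v).card +
      (A.filter fun e => (ends e).2.1 = v).card) : ℕ) : ℤ) = 2 * A.card := by
    rw [sum_add_distrib, ← card_eq_sum_card_fiberwise (s := A) (f := fun e => (ends e).1.1) h1,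
      ← card_eq_sum_card_fiberwise (s := A) (f := fun e => (ends e).2.1) h2]
    push_cast
    ring
  have hc := h.card_le_of_invariant (W ×ˢ univ) (by
    obtain ⟨e, he⟩ := hA
    exact ⟨((ends e).1.1, 0), by simpa using h1 e he⟩) (by simp [flipLift])
  have he : edgesIn flipLift ends A (W ×ˢ univ) = A := by
    ext e
    rw [mem_edgesIn]
    refine ⟨fun h => h.1, fun h => ⟨h, Or.inl ?_⟩⟩
    simpa using ⟨h1 e h, h2 e h⟩
  rw [he, card_product, card_univ, ZMod.card] at hc
  have hlt : ∑ v ∈ W, ((A.filter fun e => (ends e).1.1 = v).card +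
      (A.filter fun e => (ends e).2.1 = v).card) < ∑ v ∈ W, 4 := by
    rw [sum_const, smul_eq_mul]
    push_cast at hc hs
    zify
    linarith
  obtain ⟨v, hv, hv4⟩ := exists_lt_of_sum_lt hlt
  refine ⟨v, ?_, by omega⟩
  rcases mem_union.1 hv with hv | hv <;> obtain ⟨e, he, rfl⟩ := mem_image.1 hv
  · exact Nat.add_pos_left (card_pos.2 ⟨e, by simp [he]⟩) _
  · exact Nat.add_pos_right _ (card_pos.2 ⟨e, by simp [he]⟩)

/-- The number of loops at a vertex of a sparse graph is at most `2 - ℓ`. -/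
theorem IsSparse.card_loops_le (h : IsSparse flipLift ℓ ends A) (v : V) :
    ((A.filter fun e => (ends e).1.1 = v ∧ (ends e).2.1 = v).card : ℤ) ≤ 2 - ℓ := by
  have h1 := h.card_le_of_invariant ({v} ×ˢ univ) ⟨(v, 0), by simp⟩ (by simp [flipLift])
  rw [card_product, card_univ, ZMod.card, card_singleton] at h1
  refine le_trans ?_ h1
  have hsub : (A.filter fun e => (ends e).1.1 = v ∧ (ends e).2.1 = v) ⊆
      edgesIn flipLift ends A ({v} ×ˢ univ) := by
    intro e he
    rw [mem_filter] at he
    rw [mem_edgesIn]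
    exact ⟨he.1, Or.inl (by simpa only [mem_product, mem_singleton, mem_univ, and_true] using he.2)⟩
  exact_mod_cast card_le_card hsub

variable [DecidableEq E]

/-- Half-edges with the same ends violate sparsity. -/
theorem IsSparse.half_edge_ne (h : IsSparse flipLift ℓ ends A) {e₁ e₂ : E} (he : e₁ ≠ e₂) (he₁ : e₁ ∈ A)
    (he₂ : e₂ ∈ A) {a b : V × ZMod 2} (ha : IsHalfEdge B (ends e₁) v a)
    (hb : IsHalfEdge B (ends e₂) v b) : a ≠ b := by
  rintro rfl
  have h1 := h.card_le_of_balanced {(v, 0), a} (by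
    have h0 := ha.fst_ne
    intro c hc hc'
    simp only [mem_insert, mem_singleton] at hc hc'
    rcases hc with rfl | rfl <;> rcases hc' with hc' | hc'
    · exact flipLift_ne _ hc'
    · exact h0 (congrArg Prod.fst hc').symm
    · exact h0 (congrArg Prod.fst hc')
    · exact flipLift_ne _ hc') (by rw [card_pair (ha.ne 0).symm])
  have h2 : ({e₁, e₂} : Finset E) ⊆ edgesIn flipLift ends A {(v, 0), a} := by
    simp only [insert_subset_iff, singleton_subset_iff]
    exact ⟨mem_edgesIn.2 ⟨he₁, ha.mem _ (by simp) (by simp)⟩,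
      mem_edgesIn.2 ⟨he₂, hb.mem _ (by simp) (by simp)⟩⟩
  have h3 := card_le_card h2
  rw [card_pair he] at h3
  rw [card_pair (ha.ne 0).symm] at h1
  push_cast at h1
  omega

/-- Removing a vertex of degree three from a sparse graph, and adding a suitable edge between its
neighbors, leaves a sparse graph. -/
theorem IsSparse.exists_update (hℓ : 1 ≤ ℓ) {e₁ e₂ e₃ : E} (h12 : e₁ ≠ e₂) (h13 : e₁ ≠ e₃)
    (h23 : e₂ ≠ e₃) (he₁ : e₁ ∉ H) (he₂ : e₂ ∉ H) (he₃ : e₃ ∉ H)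
    (h : IsSparse flipLift ℓ ends ({e₁, e₂, e₃} ∪ H))
    (hH : ∀ e ∈ H, (ends e).1.1 ≠ v ∧ (ends e).2.1 ≠ v) {a b c : V × ZMod 2}
    (ha : IsHalfEdge B (ends e₁) v a) (hb : IsHalfEdge B (ends e₂) v b)
    (hc : IsHalfEdge B (ends e₃) v c) :
    a ≠ b ∧ a ≠ c ∧ b ≠ c ∧
    (IsSparse flipLift ℓ (Function.update ends e₁ (a, b)) (insert e₁ H) ∨
      IsSparse flipLift ℓ (Function.update ends e₂ (b, c)) (insert e₂ H) ∨
      IsSparse flipLift ℓ (Function.update ends e₁ (a, c)) (insert e₁ H)) := by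
  have hm1 : e₁ ∈ ({e₁, e₂, e₃} ∪ H : Finset E) := by simp
  have hm2 : e₂ ∈ ({e₁, e₂, e₃} ∪ H : Finset E) := by simp
  have hm3 : e₃ ∈ ({e₁, e₂, e₃} ∪ H : Finset E) := by simp
  have hab := h.half_edge_ne h12 hm1 hm2 ha hb
  have hac := h.half_edge_ne h13 hm1 hm3 ha hc
  have hbc := h.half_edge_ne h23 hm2 hm3 hb hc
  refine ⟨hab, hac, hbc, ?_⟩
  have hS : IsSparse flipLift ℓ ends H := h.mono subset_union_right
  have hrel : IsSparseRel flipLift ℓ ends H {a, b, c} := by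
    refine h.isSparseRel flipLift_involutive flipLift_ne subset_union_right (w := (v, 0))
      (N := {e₁, e₂, e₃}) ?_ (by simp [he₁, he₂, he₃]) (card_eq_three.2 ⟨_, _, _, h12, h13, h23, rfl⟩)
      ?_ (ha.ne 0) (ha.ne _) (hb.ne 0) (hb.ne _) (hc.ne 0) (hc.ne _)
    · intro e he
      obtain ⟨n1, n2⟩ := hH e he
      exact ⟨fun hh => n1 (congrArg Prod.fst hh), fun hh => n2 (congrArg Prod.fst hh),
        fun hh => n1 (congrArg Prod.fst hh), fun hh => n2 (congrArg Prod.fst hh)⟩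
    · intro X hw hXa hXb hXc
      simp only [insert_subset_iff, singleton_subset_iff]
      exact ⟨mem_edgesIn.2 ⟨hm1, ha.mem _ hw hXa⟩, mem_edgesIn.2 ⟨hm2, hb.mem _ hw hXb⟩,
        mem_edgesIn.2 ⟨hm3, hc.mem _ hw hXc⟩⟩
  by_contra hcon
  push Not at hcon
  refine hrel.not_isBlocked_triple flipLift_involutive flipLift_ne hℓ hab hac hbc ?_ ?_ ?_
  · by_contra hbl
    exact hcon.1 (hS.update flipLift_involutive hab hbl he₁)
  · by_contra hbl
    exact hcon.2.1 (hS.update flipLift_involutive hbc hbl he₂)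
  · by_contra hbl
    exact hcon.2.2 (hS.update flipLift_involutive hac hbl he₁)

/-- Sparse graphs have independent rows in some position. -/
theorem IsSparse.exists_stressFree [Finite V] (hB : IsReflectionForm B)
    (hℓ : ℓ = 2 ∨ (ℓ = 1 ∧ B = dotForm)) (h : IsSparse flipLift ℓ ends A) :
    ∃ p, StressFree B ends A p := by
  have hℓ1 : 1 ≤ ℓ := by omega
  -- `ends` varies because the edge added between two neighbors reuses the label of a removed edge.
  induction hn : A.card using Nat.strong_induction_on generalizing ends A with
  | _ n ih =>
  rcases A.eq_empty_or_nonempty with rfl | hA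
  · exact ⟨0, fun ω _ e he => by simp at he⟩
  obtain ⟨v, hv1, hv2⟩ := h.exists_degree_le_three hℓ1 hA
  set N := A.filter fun e => (ends e).1.1 = v ∨ (ends e).2.1 = v with hN
  set L := A.filter fun e => (ends e).1.1 = v ∧ (ends e).2.1 = v with hL
  set H := A.filter fun e => ¬ ((ends e).1.1 = v ∨ (ends e).2.1 = v) with hH'
  have hNL : N.card + L.card = (A.filter fun e => (ends e).1.1 = v).card +
      (A.filter fun e => (ends e).2.1 = v).card := by
    rw [hN, hL, filter_or, filter_and, card_union_add_card_inter]
  have hLN : L ⊆ N := fun e he => by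
    simp only [hL, hN, mem_filter] at he ⊢
    tauto
  have hAN : N ∪ H = A := filter_union_filter_not_eq _ _
  have hH : ∀ e ∈ H, (ends e).1.1 ≠ v ∧ (ends e).2.1 ≠ v := fun e he => by
    simpa [hH'] using (mem_filter.1 he).2
  have hdis : Disjoint N H := disjoint_filter_filter_not _ _ _
  have hcard : N.card + H.card = A.card := by rw [← card_union_of_disjoint hdis, hAN]
  have hLle := h.card_loops_le v
  rw [← hL] at hLle
  have hnot : ∀ e ∈ N, e ∉ H := fun e he => disjoint_left.1 hdis he
  have hNmem : ∀ e ∈ N, (ends e).1.1 = v ∨ (ends e).2.1 = v := fun e he => (mem_filter.1 he).2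
  have hNL' : ∀ e ∈ N, e ∉ L → ¬ ((ends e).1.1 = v ∧ (ends e).2.1 = v) := fun e he hl hh =>
    hl (mem_filter.2 ⟨(mem_filter.1 he).1, hh⟩)
  have hhalf : ∀ e ∈ N, e ∉ L → ∃ a, IsHalfEdge B (ends e) v a := fun e he hl =>
    exists_isHalfEdge hB (hNmem e he) (hNL' e he hl)
  have hpos : 0 < N.card := by
    have := card_le_card hLN
    omega
  rw [← hAN]
  have hS : IsSparse flipLift ℓ ends H := h.mono (hAN ▸ subset_union_right)
  obtain ⟨p, hp⟩ := ih H.card (by omega) hS rfl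
  rcases L.eq_empty_or_nonempty with hL0 | ⟨e₀, he₀⟩
  · have hN3 : N.card ≤ 3 := by omega
    have hhalf' : ∀ e ∈ N, ∃ a, IsHalfEdge B (ends e) v a := fun e he =>
      hhalf e he (by simp [hL0])
    have hNc : N.card = 1 ∨ N.card = 2 ∨ N.card = 3 := by omega
    rcases hNc with hN1 | hN1 | hN1
    · obtain ⟨e₁, hNe⟩ := card_eq_one.1 hN1
      obtain ⟨a, ha⟩ := hhalf' e₁ (by simp [hNe])
      rw [hNe]
      exact exists_stressFree_of_one_edge hB hp hH (hnot _ (by simp [hNe])) ha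
    · obtain ⟨e₁, e₂, h12, hNe⟩ := card_eq_two.1 hN1
      obtain ⟨a, ha⟩ := hhalf' e₁ (by simp [hNe])
      obtain ⟨b, hb⟩ := hhalf' e₂ (by simp [hNe])
      have hab := h.half_edge_ne h12 (by simp [← hAN, hNe]) (by simp [← hAN, hNe]) ha hb
      rw [hNe]
      exact exists_stressFree_of_two_edges hB hp hH h12 (hnot _ (by simp [hNe]))
        (hnot _ (by simp [hNe])) ha hb hab
    · obtain ⟨e₁, e₂, e₃, h12, h13, h23, hNe⟩ := card_eq_three.1 hN1
      obtain ⟨a, ha⟩ := hhalf' e₁ (by simp [hNe])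
      obtain ⟨b, hb⟩ := hhalf' e₂ (by simp [hNe])
      obtain ⟨c, hc⟩ := hhalf' e₃ (by simp [hNe])
      have hn1 := hnot e₁ (by simp [hNe])
      have hn2 := hnot e₂ (by simp [hNe])
      have hn3 := hnot e₃ (by simp [hNe])
      have h' : IsSparse flipLift ℓ ends ({e₁, e₂, e₃} ∪ H) := by rwa [← hNe, hAN]
      obtain ⟨hab, hac, hbc, hupd⟩ := h'.exists_update hℓ1 h12 h13 h23 hn1 hn2 hn3 hH ha hb hc
      rw [hNe]
      rcases hupd with hupd | hupd | hupd
      · obtain ⟨q, hq⟩ := ih (insert e₁ H).card (by rw [card_insert_of_notMem hn1]; omega) hupd rfl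
        exact exists_stressFree_of_three_edges hB hH h12 h13 h23 hn1 hn2 hn3 ha hb hc hab hac hbc hq
      · obtain ⟨q, hq⟩ := ih (insert e₂ H).card (by rw [card_insert_of_notMem hn2]; omega) hupd rfl
        have hset : ({e₁, e₂, e₃} : Finset E) = {e₂, e₃, e₁} := by ext; simp; tauto
        rw [hset]
        exact exists_stressFree_of_three_edges hB hH h23 h12.symm h13.symm hn2 hn3 hn1 hb hc ha hbc
          hab.symm hac.symm hq
      · obtain ⟨q, hq⟩ := ih (insert e₁ H).card (by rw [card_insert_of_notMem hn1]; omega) hupd rfl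
        have hset : ({e₁, e₂, e₃} : Finset E) = {e₁, e₃, e₂} := by ext; simp; tauto
        rw [hset]
        exact exists_stressFree_of_three_edges hB hH h13 h12 h23.symm hn1 hn3 hn2 ha hc hb hac
          hab hbc.symm hq
  · have hLpos : 0 < L.card := card_pos.2 ⟨e₀, he₀⟩
    -- A vertex has at most `2 - ℓ` loops, so a loop forces `ℓ = 1`.
    have hdot : B = dotForm := (hℓ.resolve_left (by omega)).2
    subst hdot
    have he₀N := hLN he₀
    have he₀A : e₀ ∈ A := (mem_filter.1 he₀).1
    obtain ⟨hf1, hf2⟩ := (mem_filter.1 he₀).2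
    have hL1 : L.card = 1 := by omega
    have hNc : N.card = 1 ∨ N.card = 2 := by omega
    rcases hNc with hN1 | hN1
    · obtain ⟨e₁, hNe⟩ := card_eq_one.1 hN1
      have : e₀ = e₁ := by simpa [hNe] using he₀N
      subst this
      rw [hNe]
      exact exists_stressFree_of_loop hp hH (hnot _ he₀N) (h.ends_ne _ he₀A) hf1 hf2
    · obtain ⟨e₁, he₁⟩ := card_eq_one.1 (show (N.erase e₀).card = 1 by
        rw [card_erase_of_mem he₀N, hN1])
      have hNe : N = {e₀, e₁} := by rw [← insert_erase he₀N, he₁]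
      have he₁' : e₁ ∈ N.erase e₀ := by simp [he₁]
      have h01 : e₁ ≠ e₀ := (mem_erase.1 he₁').1
      have he₁N := (mem_erase.1 he₁').2
      obtain ⟨a, ha⟩ := hhalf e₁ he₁N fun hh =>
        h01 (card_le_one.1 hL1.le _ hh _ he₀)
      rw [hNe]
      exact exists_stressFree_of_loop_edge hp hH h01.symm (hnot _ he₀N) (hnot _ he₁N)
        (h.ends_ne _ he₀A) hf1 hf2 ha

end Henneberg

end ReflectionSparsity

namespace ColoredGraph

open Finset ReflectionSparsity

variable {V E : Type*} (G : ColoredGraph V E)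

/-! ### Sparsity of the lift -/

/-- The ends of the lift of an edge which starts at second coordinate `0`. -/
def coverEnds (e : E) : (V × ZMod 2) × (V × ZMod 2) := ((G.src e, 0), (G.tgt e, G.color e))

variable {G} {F : Set E}

/-- The colors are a coboundary, so `ρ` factors through the boundary map and vanishes on cycles. -/
theorem rho_eq_of_potential {φ : V → ZMod 2} (hφ : ∀ e ∈ F, G.color e = φ (G.tgt e) - φ (G.src e))
    {z : E →₀ ℤ} (hz : z ∈ Finsupp.supported ℤ ℤ F) :
    G.rho z = Finsupp.linearCombination ℤ φ (G.boundary z) := by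
  rw [rho, boundary, Finsupp.linearCombination_apply, Finsupp.linearCombination_apply ℤ z,
    map_finsuppSum]
  refine Finsupp.sum_congr fun e he => ?_
  rw [map_smul, map_sub, Finsupp.linearCombination_single, Finsupp.linearCombination_single,
    one_smul, one_smul, hφ e ((Finsupp.mem_supported _ _).1 hz he)]

theorem trivialRho_of_potential {φ : V → ZMod 2}
    (hφ : ∀ e ∈ F, G.color e = φ (G.tgt e) - φ (G.src e)) : G.TrivialRho F := by
  rw [TrivialRho, eq_bot_iff]
  rintro _ ⟨z, hz, rfl⟩
  have h1 : z ∈ Finsupp.supported ℤ ℤ F := hz.1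
  have h2 : G.boundary z = 0 := hz.2
  rw [rho_eq_of_potential hφ h1, h2, map_zero]
  exact Submodule.zero_mem _

theorem componentEdges_subset (c : Quotient (G.connSetoid F)) : G.componentEdges F c ⊆ F :=
  fun _ he => he.1

theorem componentOf_tgt {e : E} (he : e ∈ F) :
    G.componentOf F (G.tgt e) = G.componentOf F (G.src e) :=
  (Quotient.sound (Relation.EqvGen.rel _ _ ⟨e, he, rfl, rfl⟩ : G.connSetoid F _ _)).symm

theorem componentOf_mem_components {e : E} (he : e ∈ F) :
    G.componentOf F (G.src e) ∈ G.components F :=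
  ⟨_, Or.inl ⟨e, he, rfl⟩, rfl⟩

theorem exists_edge_of_mem_components {c : Quotient (G.connSetoid F)} (hc : c ∈ G.components F) :
    ∃ e, e ∈ G.componentEdges F c := by
  obtain ⟨v, ⟨e, he, rfl⟩ | ⟨e, he, rfl⟩, rfl⟩ := hc
  · exact ⟨e, he, rfl⟩
  · exact ⟨e, he, (componentOf_tgt he).symm⟩

section Count

variable [Finite V]

theorem numNontrivial_add_numTrivial (F : Set E) :
    G.numNontrivial F + G.numTrivial F = (G.components F).ncard := by
  rw [numNontrivial, numTrivial, add_comm, ← Set.ncard_union_eq]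
  · congr 1
    ext c
    simp only [Set.mem_union, Set.mem_ofPred_eq]
    tauto
  · rw [Set.disjoint_left]
    rintro c hc hc'
    exact hc'.2 hc.2

theorem one_le_numNontrivial_add_numTrivial (hF : F.Nonempty) :
    1 ≤ G.numNontrivial F + G.numTrivial F := by
  rw [numNontrivial_add_numTrivial, Nat.one_le_iff_ne_zero, ← Nat.pos_iff_ne_zero, Set.ncard_pos]
  obtain ⟨e, he⟩ := hF
  exact ⟨_, componentOf_mem_components he⟩

theorem numNontrivial_eq_zero_of_potential {φ : V → ZMod 2}
    (hφ : ∀ e ∈ F, G.color e = φ (G.tgt e) - φ (G.src e)) : G.numNontrivial F = 0 := by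
  rw [numNontrivial, Set.ncard_eq_zero, Set.eq_empty_iff_forall_notMem]
  rintro c ⟨-, hc⟩
  exact hc (trivialRho_of_potential fun e he => hφ e (componentEdges_subset c he))

variable (G)

/-- The count `m' ≤ 2n' - ℓc' - 3c₀'` for all subgraphs with edges in `A`. -/
def SatisfiesCount (ℓ : ℤ) (A : Set E) : Prop :=
  ∀ F : Set E, F ⊆ A → (F.ncard : ℤ) ≤
    2 * (G.spannedVertices F).ncard - ℓ * G.numNontrivial F - 3 * G.numTrivial F

variable {G} {ℓ : ℤ} {A : Finset E}

/-- There is at least one component, and each costs at least `ℓ`. -/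
theorem SatisfiesCount.ncard_le (h : G.SatisfiesCount ℓ A) (hℓ : 1 ≤ ℓ) (hℓ3 : ℓ ≤ 3) (hF : F ⊆ A)
    (hne : F.Nonempty) : (F.ncard : ℤ) ≤ 2 * (G.spannedVertices F).ncard - ℓ := by
  have h1 := h F hF
  have h2 := one_le_numNontrivial_add_numTrivial (G := G) hne
  zify at h2
  nlinarith [Int.natCast_nonneg (G.numTrivial F)]

theorem SatisfiesCount.ncard_le_of_potential (h : G.SatisfiesCount ℓ A) (hF : F ⊆ A)
    (hne : F.Nonempty) {φ : V → ZMod 2}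
    (hφ : ∀ e ∈ F, G.color e = φ (G.tgt e) - φ (G.src e)) :
    (F.ncard : ℤ) ≤ 2 * (G.spannedVertices F).ncard - 3 := by
  have h1 := h F hF
  have h2 := one_le_numNontrivial_add_numTrivial (G := G) hne
  rw [numNontrivial_eq_zero_of_potential hφ] at h1 h2
  push_cast at h1
  omega

omit [Finite V] in
theorem ncard_spannedVertices_le [DecidableEq V] {X : Finset (V × ZMod 2)} :
    (G.spannedVertices (edgesIn flipLift G.coverEnds A X : Finset E)).ncard ≤ (X.image Prod.fst).card := by
  rw [← Set.ncard_coe_finset]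
  refine Set.ncard_le_ncard ?_ (Finset.finite_toSet _)
  rintro v (⟨e, he, rfl⟩ | ⟨e, he, rfl⟩) <;> rw [mem_coe, mem_edgesIn] at he <;>
    rw [mem_coe, mem_image]
  · rcases he.2 with h | h <;> exact ⟨_, h.1, rfl⟩
  · rcases he.2 with h | h <;> exact ⟨_, h.2, rfl⟩

/-- A balanced set chooses at most one lift of each vertex, which is a potential for the colors of
its edges. An invariant set is a union of fibers, so its size is twice the number of vertices below
it. -/
theorem SatisfiesCount.isSparse [DecidableEq V] (h : G.SatisfiesCount ℓ A) (hℓ : 1 ≤ ℓ)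
    (hℓ2 : ℓ ≤ 2) : IsSparse flipLift ℓ G.coverEnds A := by
  have hbal : ∀ X : Finset (V × ZMod 2), (∀ c ∈ X, flipLift c ∉ X) →
      (edgesIn flipLift G.coverEnds A X).Nonempty →
      ((edgesIn flipLift G.coverEnds A X).card : ℤ) ≤ 2 * X.card - 3 := by
    intro X hX hne
    set φ : V → ZMod 2 := fun v => if (v, 0) ∈ X then 0 else 1 with hφ
    have hφX : ∀ v s, (v, s) ∈ X → φ v = s := by
      intro v s hs
      rcases zmod_two_cases s with rfl | rfl
      · simp [hφ, hs]
      · have : (v, (0 : ZMod 2)) ∉ X := fun h0 => hX _ h0 (by simpa [flipLift] using hs)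
        simp [hφ, this]
    have h1 := h.ncard_le_of_potential (F := (edgesIn flipLift G.coverEnds A X : Finset E))
      (coe_subset.2 (edgesIn_subset X)) (by exact_mod_cast hne) (φ := φ) (by
        intro e he
        rcases (mem_edgesIn.1 (mem_coe.1 he)).2 with h1 | h1 <;>
          simp only [coverEnds, flipLift] at h1 <;> rw [hφX _ _ h1.1, hφX _ _ h1.2] <;> ring)
    rw [Set.ncard_coe_finset] at h1
    have h2 := ncard_spannedVertices_le (G := G) (A := A) (X := X)
    have h3 := card_image_le (s := X) (f := Prod.fst)
    omega
  refine ⟨?_, ?_, ?_⟩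
  · intro e he heq
    -- An edge whose two lifted ends coincide would lie in a singleton, where the balanced bound is
    -- `2 - 3 < 0`.
    have h1 := hbal {(G.src e, 0)} (by
      intro c hc hc'
      rw [mem_singleton] at hc hc'
      exact flipLift_ne c (hc'.trans hc.symm)) ⟨e, mem_edgesIn.2 ⟨he, Or.inl (by
        simp only [coverEnds] at heq
        simp [coverEnds, ← heq])⟩⟩
    rw [card_singleton] at h1
    push_cast at h1
    omega
  · intro Z hne hZ
    have hsub : Z.image Prod.fst ×ˢ (univ : Finset (ZMod 2)) ⊆ Z := by
      rintro ⟨v, s⟩ hc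
      simp only [mem_product, mem_image, mem_univ, and_true] at hc
      obtain ⟨c, hc, hcv⟩ := hc
      rcases eq_or_eq_flip_of_fst_eq (c := (v, s)) (v := c.1) hcv.symm c.2 with h1 | h1
      · rwa [h1]
      · rw [h1]
        exact hZ _ hc
    have hcard := card_le_card hsub
    rw [card_product, card_univ, ZMod.card] at hcard
    have h2 := ncard_spannedVertices_le (G := G) (A := A) (X := Z)
    rcases (edgesIn flipLift G.coverEnds A Z).eq_empty_or_nonempty with h0 | h0
    · have := card_pos.2 (hne.image Prod.fst)
      rw [h0, card_empty]
      push_cast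
      omega
    · have h1 := h.ncard_le hℓ (by omega) (F := (edgesIn flipLift G.coverEnds A Z : Finset E))
        (coe_subset.2 (edgesIn_subset Z)) (by exact_mod_cast h0)
      rw [Set.ncard_coe_finset] at h1
      omega
  · intro X hX h2
    rcases (edgesIn flipLift G.coverEnds A X).eq_empty_or_nonempty with h0 | h0
    · rw [h0, card_empty]
      push_cast
      omega
    · exact hbal X hX h0

end Count

/-! ### Potentials on components with trivial `ρ`-image -/

/-- The chain has to stay in the component, since triviality of `ρ` is known one component at a
time. -/
theorem exists_chain {u v : V} (h : Relation.EqvGen (fun u v => ∃ e ∈ F, G.src e = u ∧ G.tgt e = v) u v) :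
    ∃ z ∈ Finsupp.supported ℤ ℤ (G.componentEdges F (G.componentOf F u)),
      G.boundary z = Finsupp.single v 1 - Finsupp.single u 1 := by
  induction h with
  | rel u v h =>
    obtain ⟨e, he, rfl, rfl⟩ := h
    refine ⟨Finsupp.single e 1, Finsupp.single_mem_supported _ _ ⟨he, rfl⟩, ?_⟩
    simp [boundary]
  | refl u => exact ⟨0, Submodule.zero_mem _, by simp⟩
  | symm u v h ih =>
    obtain ⟨z, hz, hz'⟩ := ih
    have : G.componentOf F u = G.componentOf F v := Quotient.sound h
    exact ⟨-z, this ▸ Submodule.neg_mem _ hz, by simp [hz']⟩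
  | trans u v w h1 h2 ih1 ih2 =>
    obtain ⟨z, hz, hz'⟩ := ih1
    obtain ⟨y, hy, hy'⟩ := ih2
    have : G.componentOf F u = G.componentOf F v := Quotient.sound h1
    exact ⟨z + y, Submodule.add_mem _ hz (this ▸ hy), by simp [hz', hy']⟩

/-- `φ v` is the color sum of a chain from the representative of the component to `v`. Going to the
tail of `e`, along `e` and back from its head is a cycle, of color sum 0. -/
theorem exists_potential (G : ColoredGraph V E) (F : Set E) : ∃ φ : V → ZMod 2,
    ∀ c, G.TrivialRho (G.componentEdges F c) →
      ∀ e ∈ G.componentEdges F c, G.color e = φ (G.tgt e) - φ (G.src e) := by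
  have hroot : ∀ v, Relation.EqvGen (fun u v => ∃ e ∈ F, G.src e = u ∧ G.tgt e = v)
      (G.componentOf F v).out v := fun v => Quotient.mk_out (s := G.connSetoid F) v
  choose z hz hz' using fun v => exists_chain (hroot v)
  have hcomp : ∀ v, G.componentOf F (G.componentOf F v).out = G.componentOf F v := fun v =>
    Quotient.out_eq (s := G.connSetoid F) _
  refine ⟨fun v => G.rho (z v), ?_⟩
  rintro c hc e ⟨he, rfl⟩
  have hcyc : z (G.src e) + Finsupp.single e 1 - z (G.tgt e) ∈
      G.cycles (G.componentEdges F (G.componentOf F (G.src e))) := by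
    refine ⟨Submodule.sub_mem _ (Submodule.add_mem _ ?_ ?_) ?_, ?_⟩
    · have := hz (G.src e)
      rwa [hcomp] at this
    · exact Finsupp.single_mem_supported _ _ ⟨he, rfl⟩
    · have := hz (G.tgt e)
      rwa [hcomp, componentOf_tgt he] at this
    · rw [SetLike.mem_coe, LinearMap.mem_ker, map_sub, map_add, hz', hz', componentOf_tgt he]
      simp [boundary]
  have h0 : G.rho (z (G.src e) + Finsupp.single e 1 - z (G.tgt e)) = 0 := by
    have : G.rho (z (G.src e) + Finsupp.single e 1 - z (G.tgt e)) ∈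
        (G.cycles (G.componentEdges F (G.componentOf F (G.src e)))).map G.rho :=
      Submodule.mem_map_of_mem hcyc
    rw [hc] at this
    simpa using this
  have h1 : G.rho (Finsupp.single e 1) = G.color e := by simp [rho]
  rw [map_sub, map_add, h1] at h0
  linear_combination h0

end ColoredGraph

namespace ColoredGraph

open Finset ReflectionSparsity

variable {V E : Type*} {G : ColoredGraph V E} {F : Set E}

/-! ### Counts from independent equations -/

section Independence

variable {M ι : Type*} [AddCommGroup M] [Module ℝ M]

/-- The linear functionals `L e`, for `e` in `A`, take arbitrary values simultaneously. -/
def TakesAllValues (L : ι → M →ₗ[ℝ] ℝ) (A : Set ι) : Prop :=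
  ∀ w : ι → ℝ, ∃ x, ∀ e ∈ A, L e x = w e

theorem TakesAllValues.mono {L : ι → M →ₗ[ℝ] ℝ} {A A' : Set ι} (h : TakesAllValues L A)
    (hA : A' ⊆ A) : TakesAllValues L A' := fun w => by
  obtain ⟨x, hx⟩ := h w
  exact ⟨x, fun e he => hx e (hA he)⟩

/-- The common zeros of the functionals `L e`, for `e` in `A`. -/
def commonKer (L : ι → M →ₗ[ℝ] ℝ) (A : Set ι) : Submodule ℝ M :=
  LinearMap.ker (LinearMap.pi fun e : A => L e)

theorem mem_commonKer {L : ι → M →ₗ[ℝ] ℝ} {A : Set ι} {x : M} :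
    x ∈ commonKer L A ↔ ∀ e ∈ A, L e x = 0 := by
  simp [commonKer, funext_iff]

variable [Finite ι] [FiniteDimensional ℝ M]

theorem TakesAllValues.finrank_commonKer {L : ι → M →ₗ[ℝ] ℝ} {A : Set ι} (h : TakesAllValues L A) :
    Module.finrank ℝ (commonKer L A) + A.ncard = Module.finrank ℝ M := by
  classical
  have := Fintype.ofFinite A
  have h1 := LinearMap.finrank_range_add_finrank_ker (LinearMap.pi fun e : A => L e)
  have h2 : LinearMap.range (LinearMap.pi fun e : A => L e) = ⊤ := by
    rw [LinearMap.range_eq_top]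
    intro w
    obtain ⟨x, hx⟩ := h fun e => if he : e ∈ A then w ⟨e, he⟩ else 0
    refine ⟨x, ?_⟩
    ext e
    simpa using hx e.1 e.2
  rw [h2, finrank_top, Module.finrank_fintype_fun_eq_card, ← Nat.card_eq_fintype_card,
    Nat.card_coe_set_eq] at h1
  rw [← h1, commonKer, add_comm]

theorem takesAllValues_univ {L : ι → M →ₗ[ℝ] ℝ}
    (h : Module.finrank ℝ (commonKer L Set.univ) + Nat.card ι ≤ Module.finrank ℝ M) :
    TakesAllValues L Set.univ := by
  classical
  have := Fintype.ofFinite ι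
  have h1 := LinearMap.finrank_range_add_finrank_ker (LinearMap.pi L)
  have h2 : LinearMap.ker (LinearMap.pi L) = commonKer L Set.univ := by
    ext x
    simp [mem_commonKer, funext_iff]
  have h3 : LinearMap.range (LinearMap.pi L) = ⊤ := by
    apply Submodule.eq_top_of_finrank_eq
    have := Submodule.finrank_le (LinearMap.range (LinearMap.pi L))
    rw [Module.finrank_fintype_fun_eq_card, ← Nat.card_eq_fintype_card] at this ⊢
    rw [h2] at h1
    omega
  intro w
  obtain ⟨x, hx⟩ := LinearMap.range_eq_top.1 h3 w
  exact ⟨x, fun e _ => congrFun hx e⟩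

/-- Every number up to the rank is the size of an independent subfamily. -/
theorem exists_takesAllValues {L : ι → M →ₗ[ℝ] ℝ} (k : ℕ)
    (hk : Module.finrank ℝ (commonKer L Set.univ) + k ≤ Module.finrank ℝ M) :
    ∃ A : Set ι, A.ncard = k ∧ TakesAllValues L A := by
  induction k with
  | zero => exact ⟨∅, by simp, fun w => ⟨0, by simp⟩⟩
  | succ k ih =>
    obtain ⟨A, hA, hL⟩ := ih (by omega)
    have h1 := hL.finrank_commonKer
    -- Below the full rank some vector is killed by `A` but not by all functionals; a functional
    -- that sees it can be added.
    have h2 : ¬ commonKer L A ≤ commonKer L Set.univ := fun hle => by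
      have := Submodule.finrank_mono hle
      omega
    obtain ⟨u, hu, hu'⟩ := Set.not_subset.1 h2
    have hu0 : ∀ e ∈ A, L e u = 0 := mem_commonKer.1 hu
    have hu1 : ∃ e, L e u ≠ 0 := by
      by_contra hcon
      push Not at hcon
      exact hu' (mem_commonKer.2 fun e _ => hcon e)
    obtain ⟨e₀, he₀⟩ := hu1
    have he₀A : e₀ ∉ A := fun h => he₀ (hu0 _ h)
    refine ⟨insert e₀ A, by rw [Set.ncard_insert_of_notMem he₀A, hA], fun w => ?_⟩
    obtain ⟨x, hx⟩ := hL w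
    refine ⟨x + ((w e₀ - L e₀ x) / L e₀ u) • u, ?_⟩
    rintro e (rfl | he)
    · rw [map_add, map_smul, smul_eq_mul]
      field_simp
      ring
    · rw [map_add, map_smul, hu0 e he, hx e he, smul_zero, add_zero]

end Independence

variable (G) in
/-- The equations of the edges in `C` have a `k`-dimensional space of solutions, even after
restriction to the ends of these edges. -/
def HasSolutionSpace (L : E → (V → ℝ × ℝ) →ₗ[ℝ] ℝ) (C : Set E) (k : ℕ) : Prop :=
  ∃ ψ : (Fin k → ℝ) →ₗ[ℝ] (V → ℝ × ℝ), (∀ w, ∀ e ∈ C, L e (ψ w) = 0) ∧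
    ∀ w, (∀ e ∈ C, ψ w (G.src e) = 0 ∧ ψ w (G.tgt e) = 0) → w = 0

/-- A family of independent edge equations, with a `k c`-dimensional space of solutions over each
component `c` of the subgraph. -/
theorem ncard_add_sum_le [Finite V] [Finite E] {L : E → (V → ℝ × ℝ) →ₗ[ℝ] ℝ}
    (hloc : ∀ e u u', u (G.src e) = u' (G.src e) → u (G.tgt e) = u' (G.tgt e) → L e u = L e u')
    (hL : TakesAllValues L F) [Fintype (G.components F)] (k : Quotient (G.connSetoid F) → ℕ)
    (hk : ∀ c ∈ G.components F, G.HasSolutionSpace L (G.componentEdges F c) (k c)) :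
    F.ncard + ∑ c : G.components F, k c ≤ 2 * (G.spannedVertices F).ncard := by
  classical
  have := Fintype.ofFinite V
  choose ψ hψ hinj using fun c : G.components F => hk c.1 c.2
  have hcomp : ∀ v, v ∈ G.spannedVertices F → G.componentOf F v ∈ G.components F :=
    fun v hv => ⟨v, hv, rfl⟩
  -- `T` glues arbitrary values off the spanned vertices with one chosen solution on each component.
  -- It is injective into the solutions for `F`, whose dimension is `2n - |F|`.
  let T : ((((G.spannedVertices F)ᶜ : Set V) → ℝ × ℝ) × (∀ c : G.components F, Fin (k c) → ℝ)) →ₗ[ℝ]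
      (V → ℝ × ℝ) := LinearMap.pi fun v =>
    if h : v ∈ G.spannedVertices F then
      LinearMap.proj v ∘ₗ ψ ⟨_, hcomp v h⟩ ∘ₗ LinearMap.proj _ ∘ₗ LinearMap.snd ℝ _ _
    else LinearMap.proj (⟨v, h⟩ : ((G.spannedVertices F)ᶜ : Set V)) ∘ₗ LinearMap.fst ℝ _ _
  have hT1 : ∀ x (c : G.components F) v, v ∈ G.spannedVertices F → G.componentOf F v = c →
      T x v = ψ c (x.2 c) v := by
    rintro x ⟨c, hc⟩ v hv rfl
    simp [T, hv]
  have hT2 : ∀ x (v : ((G.spannedVertices F)ᶜ : Set V)), T x v = x.1 v := by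
    rintro x ⟨v, hv⟩
    simp only [Set.mem_compl_iff] at hv
    simp [T, hv]
  have hsrc : ∀ e ∈ F, G.src e ∈ G.spannedVertices F := fun e he => Or.inl ⟨e, he, rfl⟩
  have htgt : ∀ e ∈ F, G.tgt e ∈ G.spannedVertices F := fun e he => Or.inr ⟨e, he, rfl⟩
  have hTinj : Function.Injective T := by
    rw [← LinearMap.ker_eq_bot, LinearMap.ker_eq_bot']
    intro x hx
    refine Prod.ext ?_ ?_
    · ext v : 1
      rw [← hT2 x v, hx]
      rfl
    · ext c : 1
      refine hinj c _ fun e he => ?_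
      have h1 := hT1 x c _ (hsrc e he.1) he.2
      have h2 := hT1 x c _ (htgt e he.1) ((componentOf_tgt he.1).trans he.2)
      rw [← h1, ← h2, hx]
      exact ⟨rfl, rfl⟩
  have hrange : LinearMap.range T ≤ commonKer L F := by
    rintro _ ⟨x, rfl⟩
    rw [mem_commonKer]
    intro e he
    rw [← hψ ⟨_, componentOf_mem_components he⟩ (x.2 _) e ⟨he, rfl⟩]
    exact hloc e _ _ (hT1 x _ _ (hsrc e he) rfl) (hT1 x _ _ (htgt e he) (componentOf_tgt he))
  have h1 := hL.finrank_commonKer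
  have h2 := Submodule.finrank_mono hrange
  rw [LinearMap.finrank_range_of_inj hTinj, Module.finrank_prod, Module.finrank_pi_fintype,
    Module.finrank_pi_fintype] at h2
  rw [Module.finrank_pi_fintype] at h1
  simp only [Module.finrank_prod, Module.finrank_self, sum_const, card_univ, smul_eq_mul,
    Module.finrank_fintype_fun_eq_card, Fintype.card_fin] at h1 h2
  rw [← Nat.card_eq_fintype_card (α := V)] at h1
  rw [← Nat.card_eq_fintype_card (α := ((G.spannedVertices F)ᶜ : Set V)), Nat.card_coe_set_eq] at h2
  have h3 := Set.ncard_add_ncard_compl (G.spannedVertices F)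
  omega

theorem sum_components_ite [Finite V] [Fintype (G.components F)] (ℓ : ℕ)
    [DecidablePred fun c => G.TrivialRho (G.componentEdges F c)] :
    ∑ c : G.components F, (if G.TrivialRho (G.componentEdges F c) then 3 else ℓ) =
      ℓ * G.numNontrivial F + 3 * G.numTrivial F := by
  have h1 : ∀ P : Quotient (G.connSetoid F) → Prop, [DecidablePred P] →
      (univ.filter fun c : G.components F => P c).card = {c | c ∈ G.components F ∧ P c}.ncard := by
    intro P _
    rw [← card_map (Function.Embedding.subtype _), ← Set.ncard_coe_finset]
    congr 1
    ext c
    simp [and_comm]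
  have ht : (univ.filter fun c : G.components F => G.TrivialRho (G.componentEdges F c)).card =
      G.numTrivial F := h1 (fun c => G.TrivialRho (G.componentEdges F c))
  have hn : (univ.filter fun c : G.components F => ¬ G.TrivialRho (G.componentEdges F c)).card =
      G.numNontrivial F := h1 (fun c => ¬ G.TrivialRho (G.componentEdges F c))
  rw [sum_ite, sum_const, sum_const, ht, hn, smul_eq_mul, smul_eq_mul]
  ring

theorem satisfiesCount_of_solutions [Finite V] [Finite E] {A : Set E} {ℓ : ℕ}
    {L : E → (V → ℝ × ℝ) →ₗ[ℝ] ℝ}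
    (hloc : ∀ e u u', u (G.src e) = u' (G.src e) → u (G.tgt e) = u' (G.tgt e) → L e u = L e u')
    (hL : TakesAllValues L A)
    (hnontriv : ∀ C : Set E, C.Nonempty → G.HasSolutionSpace L C ℓ)
    (htriv : ∀ C : Set E, C.Nonempty → ∀ φ : V → ZMod 2,
      (∀ e ∈ C, G.color e = φ (G.tgt e) - φ (G.src e)) →
      G.HasSolutionSpace L C 3) :
    G.SatisfiesCount ℓ A := by
  classical
  intro F hF
  have := Fintype.ofFinite (G.components F)
  obtain ⟨φ, hφ⟩ := G.exists_potential F
  have h1 := ncard_add_sum_le hloc (hL.mono hF)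
    (fun c => if G.TrivialRho (G.componentEdges F c) then 3 else ℓ) fun c hc => by
      change G.HasSolutionSpace L _ (if _ then _ else _)
      split_ifs with ht
      · exact htriv _ (exists_edge_of_mem_components hc) φ (hφ c ht)
      · exact hnontriv _ (exists_edge_of_mem_components hc)
  rw [sum_components_ite] at h1
  zify at h1
  linarith

end ColoredGraph

section Coordinates

open ReflectionSparsity ColoredGraph

/-! ### Realizations in coordinates -/

/-- The point of the plane with given coordinates. -/
noncomputable def toPlane (x : ℝ × ℝ) : Plane := !₂[x.1, x.2]

@[simp] theorem toPlane_zero_coord (x : ℝ × ℝ) : toPlane x 0 = x.1 := rfl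

@[simp] theorem toPlane_one_coord (x : ℝ × ℝ) : toPlane x 1 = x.2 := rfl

theorem plane_ext {x y : Plane} (h0 : x 0 = y 0) (h1 : x 1 = y 1) : x = y := by
  ext i
  fin_cases i
  · exact h0
  · exact h1

theorem toPlane_injective : Function.Injective toPlane := by
  intro x y h
  ext
  · exact congrArg (fun z : Plane => z 0) h
  · exact congrArg (fun z : Plane => z 1) h

theorem planeAct_coord (g : ZMod 2) (x : Plane) :
    planeAct g x = toPlane (sgn g * x 0, x 1) := by
  rcases zmod_two_cases g with rfl | rfl <;> apply plane_ext <;> simp [planeAct, reflY]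

variable {V E : Type*} {G : ColoredGraph V E}

/-- The symmetric point configuration given by the positions of the lifts with second
coordinate `0`. -/
noncomputable def realize (u : V → ℝ × ℝ) (i : V × ZMod 2) : Plane := toPlane (lift i u)

theorem lift_liftAct (g : ZMod 2) (i : V × ZMod 2) (u : V → ℝ × ℝ) :
    lift (liftAct g i) u = (sgn g * (lift i u).1, (lift i u).2) := by
  ext <;> simp [liftAct, sgn_add, mul_assoc]

theorem realize_liftAct (u : V → ℝ × ℝ) (g : ZMod 2) (i : V × ZMod 2) :
    realize u (liftAct g i) = planeAct g (realize u i) := by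
  rw [realize, lift_liftAct, planeAct_coord]
  rfl

theorem exists_eq_realize {p : V × ZMod 2 → Plane}
    (hp : ∀ (g : ZMod 2) (i : V × ZMod 2), p (liftAct g i) = planeAct g (p i)) :
    ∃ u, p = realize u := by
  refine ⟨fun v => (p (v, 0) 0, p (v, 0) 1), ?_⟩
  funext ⟨v, s⟩
  have h := hp s (v, 0)
  rw [liftAct, add_zero, planeAct_coord] at h
  rw [h]
  rfl

theorem realize_liftTgt_sub (u : V → ℝ × ℝ) (e : E × ZMod 2) :
    realize u (G.liftTgt e) - realize u (G.liftSrc e) =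
      toPlane (sgn e.2 * (edgeVec (G.coverEnds e.1) u).1, (edgeVec (G.coverEnds e.1) u).2) := by
  apply plane_ext
  · simp [realize, liftTgt, liftSrc, coverEnds, edgeVec_apply, sgn_add]
    ring
  · simp [realize, liftTgt, liftSrc, coverEnds, edgeVec_apply]

/-! ### Direction networks as linear systems. -/

namespace DirectionNetwork

/-- The coordinates of the direction of the lift of `e` that starts at second coordinate `0`. -/
noncomputable def vec (d : DirectionNetwork E) (e : E) : ℝ × ℝ := (d.dir (e, 0) 0, d.dir (e, 0) 1)

/-- By symmetry the equations of both lifts of `e` are multiples of a single one, and pairing with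
the turned direction is the determinant. -/
theorem isRealization_realize_iff {d : DirectionNetwork E} {u : V → ℝ × ℝ} :
    d.IsRealization G (realize u) ↔ ∀ e, detForm (d.vec e) (edgeVec (G.coverEnds e) u) = 0 := by
  have key : ∀ e : E × ZMod 2, ∃ c : ℝ, inner ℝ (realize u (G.liftTgt e) - realize u (G.liftSrc e))
      (_root_.perp (d.dir e)) = c * detForm (d.vec e.1) (edgeVec (G.coverEnds e.1) u) := by
    rintro ⟨e, s⟩
    obtain ⟨c, hc⟩ := d.dir_symm s (e, 0)
    rw [liftAct, add_zero] at hc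
    refine ⟨c * sgn s, ?_⟩
    rw [realize_liftTgt_sub, hc, planeAct_coord]
    simp [_root_.perp, PiLp.inner_apply, Fin.sum_univ_two, vec]
    ring
  constructor
  · intro h e
    have h1 := h.1 (e, 0)
    rw [realize_liftTgt_sub] at h1
    simp [_root_.perp, PiLp.inner_apply, Fin.sum_univ_two] at h1
    rw [detForm_apply, vec]
    linear_combination h1
  · intro h
    refine ⟨fun e => ?_, realize_liftAct u⟩
    obtain ⟨c, hc⟩ := key e
    rw [hc, h, mul_zero]

theorem perp_isRealization_realize_iff {d : DirectionNetwork E} {u : V → ℝ × ℝ} :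
    d.perp.IsRealization G (realize u) ↔
      ∀ e, dotForm (d.vec e) (edgeVec (G.coverEnds e) u) = 0 := by
  rw [isRealization_realize_iff]
  refine forall_congr' fun e => ?_
  have : detForm (d.perp.vec e) (edgeVec (G.coverEnds e) u) =
      -dotForm (d.vec e) (edgeVec (G.coverEnds e) u) := by
    simp [vec, perp, _root_.perp]
    ring
  rw [this, neg_eq_zero]

theorem isFaithfulRealization_realize_iff {d : DirectionNetwork E} {u : V → ℝ × ℝ} :
    d.IsFaithfulRealization G (realize u) ↔
      (∀ e, detForm (d.vec e) (edgeVec (G.coverEnds e) u) = 0) ∧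
        ∀ e, edgeVec (G.coverEnds e) u ≠ 0 := by
  rw [IsFaithfulRealization, isRealization_realize_iff]
  refine and_congr_right fun _ => ?_
  have key : ∀ e : E × ZMod 2, realize u (G.liftSrc e) ≠ realize u (G.liftTgt e) ↔
      edgeVec (G.coverEnds e.1) u ≠ 0 := by
    intro e
    rw [ne_comm, ← sub_ne_zero, realize_liftTgt_sub, not_iff_not]
    have h0 : (0 : Plane) = toPlane 0 := plane_ext rfl rfl
    rw [h0, toPlane_injective.eq_iff, Prod.ext_iff, Prod.ext_iff]
    simp [sgn_ne_zero]
  simp only [key, Prod.forall, forall_const]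

/-- The network whose directions are the directions of the edges of a symmetric configuration. -/
noncomputable def ofPosition (G : ColoredGraph V E) (u : V → ℝ × ℝ)
    (hu : ∀ e, edgeVec (G.coverEnds e) u ≠ 0) : DirectionNetwork E where
  dir e := planeAct e.2 (toPlane (edgeVec (G.coverEnds e.1) u))
  dir_ne_zero e h := by
    apply hu e.1
    rw [planeAct_coord] at h
    have h0 := congrArg (fun z : Plane => z 0) h
    have h1 := congrArg (fun z : Plane => z 1) h
    ext
    · simpa [sgn_ne_zero] using h0
    · simpa using h1
  dir_symm g e := by
    refine ⟨1, ?_⟩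
    rw [one_smul, planeAct_coord, planeAct_coord, planeAct_coord]
    simp [liftAct, sgn_add, mul_assoc]

@[simp] theorem ofPosition_vec (u : V → ℝ × ℝ) (hu : ∀ e, edgeVec (G.coverEnds e) u ≠ 0) (e : E) :
    (ofPosition G u hu).vec e = edgeVec (G.coverEnds e) u := by
  ext <;> simp [vec, ofPosition, planeAct]

end DirectionNetwork

namespace ColoredGraph

/-! ### Necessity of the counts -/

/-- The equation of the edge `e` for the form `B` and the direction `d`. -/
noncomputable def edgeEquation (G : ColoredGraph V E) (B : ℝ × ℝ →ₗ[ℝ] ℝ × ℝ →ₗ[ℝ] ℝ)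
    (d : E → ℝ × ℝ) (e : E) : (V → ℝ × ℝ) →ₗ[ℝ] ℝ :=
  B (d e) ∘ₗ edgeVec (G.coverEnds e)

variable {B : ℝ × ℝ →ₗ[ℝ] ℝ × ℝ →ₗ[ℝ] ℝ} {d : E → ℝ × ℝ} {p : V → ℝ × ℝ}

@[simp] theorem edgeEquation_apply (e : E) (u : V → ℝ × ℝ) :
    G.edgeEquation B d e u = B (d e) (edgeVec (G.coverEnds e) u) := rfl

theorem edgeEquation_congr (e : E) (u u' : V → ℝ × ℝ) (h1 : u (G.src e) = u' (G.src e))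
    (h2 : u (G.tgt e) = u' (G.tgt e)) : G.edgeEquation B d e u = G.edgeEquation B d e u' := by
  rw [edgeEquation_apply, edgeEquation_apply, edgeVec_congr (q := u') h1 h2]

theorem edgeVec_coverEnds (e : E) (u : V → ℝ × ℝ) : edgeVec (G.coverEnds e) u =
    (sgn (G.color e) * (u (G.tgt e)).1 - (u (G.src e)).1, (u (G.tgt e)).2 - (u (G.src e)).2) := by
  ext <;> simp [edgeVec_apply, coverEnds]

theorem sgn_mul_sgn_of_potential {φ : V → ZMod 2} {e : E}
    (h : G.color e = φ (G.tgt e) - φ (G.src e)) :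
    sgn (G.color e) * sgn (φ (G.tgt e)) = sgn (φ (G.src e)) := by
  have : φ (G.src e) = G.color e + φ (G.tgt e) := by
    rw [h, sub_add_eq_add_sub, eq_sub_iff_add_eq]
    generalize φ (G.src e) = a
    generalize φ (G.tgt e) = b
    revert a b
    decide
  rw [this, sgn_add]

theorem sgn_mul_sgn_of_potential' {φ : V → ZMod 2} {e : E}
    (h : G.color e = φ (G.tgt e) - φ (G.src e)) :
    sgn (φ (G.src e)) * sgn (G.color e) = sgn (φ (G.tgt e)) := by
  rw [← sgn_mul_sgn_of_potential h, mul_right_comm, sgn_mul_self, one_mul]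

/-- The solutions are the vertical translations. -/
theorem hasSolutionSpace_dotForm_one {C : Set E} (hC : C.Nonempty) :
    G.HasSolutionSpace (G.edgeEquation dotForm d) C 1 := by
  let ψ : (Fin 1 → ℝ) →ₗ[ℝ] (V → ℝ × ℝ) :=
    { toFun w v := (0, w 0)
      map_add' w w' := by ext <;> simp
      map_smul' r w := by ext <;> simp }
  refine ⟨ψ, fun w e _ => ?_, fun w hw => ?_⟩
  · simp [ψ, edgeVec_coverEnds]
  · obtain ⟨e, he⟩ := hC
    ext i
    fin_cases i
    exact congrArg Prod.snd (hw e he).1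

/-- After each vertex is replaced by its lift of sheet `φ v`, the reflection disappears on `C`; the
solutions are the two translations and the quarter turn of `p`. Faithfulness of `p` separates the
turn from the translations. -/
theorem hasSolutionSpace_dotForm_three (hp : ∀ e, edgeVec (G.coverEnds e) p ≠ 0)
    (hd : ∀ e, detForm (d e) (edgeVec (G.coverEnds e) p) = 0) {C : Set E} (hC : C.Nonempty)
    {φ : V → ZMod 2} (hφ : ∀ e ∈ C, G.color e = φ (G.tgt e) - φ (G.src e)) :
    G.HasSolutionSpace (G.edgeEquation dotForm d) C 3 := by
  let ψ : (Fin 3 → ℝ) →ₗ[ℝ] (V → ℝ × ℝ) :=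
    { toFun w v := (sgn (φ v) * (w 0 - w 2 * (p v).2), w 1 + w 2 * (sgn (φ v) * (p v).1))
      map_add' w w' := by ext <;> simp <;> ring
      map_smul' r w := by ext <;> simp <;> ring }
  refine ⟨ψ, fun w e he => ?_, fun w hw => ?_⟩
  · have h1 := sgn_mul_sgn_of_potential (hφ e he)
    have h2 := sgn_mul_sgn_of_potential' (hφ e he)
    have h3 := hd e
    simp only [edgeVec_coverEnds, detForm_apply] at h3
    simp only [edgeEquation_apply, edgeVec_coverEnds, dotForm_apply, ψ, LinearMap.coe_mk,
      AddHom.coe_mk]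
    linear_combination ((d e).1 * (w 0 - w 2 * (p (G.tgt e)).2)) * h1 -
      ((d e).2 * w 2 * (p (G.tgt e)).1) * h2 - w 2 * sgn (φ (G.src e)) * h3
  · obtain ⟨e, he⟩ := hC
    obtain ⟨hs, ht⟩ := hw e he
    have h2 := sgn_mul_sgn_of_potential' (hφ e he)
    have s1 := congrArg Prod.fst hs
    have s2 := congrArg Prod.snd hs
    have t1 := congrArg Prod.fst ht
    have t2 := congrArg Prod.snd ht
    simp only [ψ, LinearMap.coe_mk, AddHom.coe_mk, Prod.fst_zero, Prod.snd_zero, mul_eq_zero,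
      sgn_ne_zero, false_or] at s1 s2 t1 t2
    have hw2 : w 2 = 0 := by
      by_contra h0
      apply hp e
      rw [edgeVec_coverEnds]
      have e1 : (p (G.tgt e)).2 - (p (G.src e)).2 = 0 :=
        (mul_eq_zero.1 (by linear_combination s1 - t1 :
          w 2 * ((p (G.tgt e)).2 - (p (G.src e)).2) = 0)).resolve_left h0
      have e2 : sgn (G.color e) * (p (G.tgt e)).1 - (p (G.src e)).1 = 0 := by
        refine (mul_eq_zero.1 (?_ : (w 2 * sgn (φ (G.src e))) * _ = 0)).resolve_left
          (mul_ne_zero h0 (sgn_ne_zero _))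
        linear_combination t2 - s2 + w 2 * (p (G.tgt e)).1 * h2
      rw [e1, e2]
      rfl
    have hw0 : w 0 = 0 := by simpa [hw2] using s1
    have hw1 : w 1 = 0 := by simpa [hw2] using s2
    ext i
    fin_cases i
    · exact hw0
    · exact hw1
    · exact hw2

/-- The solutions are the multiples of `p` and the vertical translations. -/
theorem hasSolutionSpace_detForm_two (hp : ∀ e, edgeVec (G.coverEnds e) p ≠ 0)
    (hd : ∀ e, detForm (d e) (edgeVec (G.coverEnds e) p) = 0) {C : Set E} (hC : C.Nonempty) :
    G.HasSolutionSpace (G.edgeEquation detForm d) C 2 := by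
  let ψ : (Fin 2 → ℝ) →ₗ[ℝ] (V → ℝ × ℝ) :=
    { toFun w v := (w 0 * (p v).1, w 1 + w 0 * (p v).2)
      map_add' w w' := by ext <;> simp <;> ring
      map_smul' r w := by ext <;> simp <;> ring }
  refine ⟨ψ, fun w e he => ?_, fun w hw => ?_⟩
  · have h3 := hd e
    simp only [edgeVec_coverEnds, detForm_apply] at h3
    simp only [edgeEquation_apply, edgeVec_coverEnds, detForm_apply, ψ, LinearMap.coe_mk,
      AddHom.coe_mk]
    linear_combination w 0 * h3
  · obtain ⟨e, he⟩ := hC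
    obtain ⟨hs, ht⟩ := hw e he
    have s1 := congrArg Prod.fst hs
    have s2 := congrArg Prod.snd hs
    have t1 := congrArg Prod.fst ht
    have t2 := congrArg Prod.snd ht
    simp only [ψ, LinearMap.coe_mk, AddHom.coe_mk, Prod.fst_zero, Prod.snd_zero] at s1 s2 t1 t2
    have hw0 : w 0 = 0 := by
      by_contra h0
      apply hp e
      rw [edgeVec_coverEnds]
      rw [mul_eq_zero, or_iff_right h0] at s1 t1
      have e1 : (p (G.tgt e)).2 - (p (G.src e)).2 = 0 :=
        (mul_eq_zero.1 (by linear_combination t2 - s2 :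
          w 0 * ((p (G.tgt e)).2 - (p (G.src e)).2) = 0)).resolve_left h0
      rw [e1, s1, t1]
      simp
    have hw1 : w 1 = 0 := by simpa [hw0] using s2
    ext i
    fin_cases i
    · exact hw0
    · exact hw1

/-- Besides scaling and vertical translation, the potential permits a horizontal translation, with
sign `sgn (φ v)` at `v`. -/
theorem hasSolutionSpace_detForm_three (hp : ∀ e, edgeVec (G.coverEnds e) p ≠ 0)
    (hd : ∀ e, detForm (d e) (edgeVec (G.coverEnds e) p) = 0) {C : Set E} (hC : C.Nonempty)
    {φ : V → ZMod 2} (hφ : ∀ e ∈ C, G.color e = φ (G.tgt e) - φ (G.src e)) :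
    G.HasSolutionSpace (G.edgeEquation detForm d) C 3 := by
  let ψ : (Fin 3 → ℝ) →ₗ[ℝ] (V → ℝ × ℝ) :=
    { toFun w v := (sgn (φ v) * w 0 + w 2 * (p v).1, w 1 + w 2 * (p v).2)
      map_add' w w' := by ext <;> simp <;> ring
      map_smul' r w := by ext <;> simp <;> ring }
  refine ⟨ψ, fun w e he => ?_, fun w hw => ?_⟩
  · have h1 := sgn_mul_sgn_of_potential (hφ e he)
    have h3 := hd e
    simp only [edgeVec_coverEnds, detForm_apply] at h3
    simp only [edgeEquation_apply, edgeVec_coverEnds, detForm_apply, ψ, LinearMap.coe_mk,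
      AddHom.coe_mk]
    linear_combination w 2 * h3 - (d e).2 * w 0 * h1
  · obtain ⟨e, he⟩ := hC
    obtain ⟨hs, ht⟩ := hw e he
    have h1 := sgn_mul_sgn_of_potential (hφ e he)
    have s1 := congrArg Prod.fst hs
    have s2 := congrArg Prod.snd hs
    have t1 := congrArg Prod.fst ht
    have t2 := congrArg Prod.snd ht
    simp only [ψ, LinearMap.coe_mk, AddHom.coe_mk, Prod.fst_zero, Prod.snd_zero] at s1 s2 t1 t2
    have hw2 : w 2 = 0 := by
      by_contra h0
      apply hp e
      rw [edgeVec_coverEnds]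
      have e1 : (p (G.tgt e)).2 - (p (G.src e)).2 = 0 :=
        (mul_eq_zero.1 (by linear_combination t2 - s2 :
          w 2 * ((p (G.tgt e)).2 - (p (G.src e)).2) = 0)).resolve_left h0
      have e2 : sgn (G.color e) * (p (G.tgt e)).1 - (p (G.src e)).1 = 0 := by
        refine (mul_eq_zero.1 (?_ : w 2 * _ = 0)).resolve_left h0
        linear_combination sgn (G.color e) * t1 - s1 - w 0 * h1
      rw [e1, e2]
      rfl
    have hw0 : w 0 = 0 := by simpa [hw2, sgn_ne_zero] using s1
    have hw1 : w 1 = 0 := by simpa [hw2] using s2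
    ext i
    fin_cases i
    · exact hw0
    · exact hw1
    · exact hw2

end ColoredGraph

end Coordinates

namespace ColoredGraph

open ReflectionSparsity

variable {V E : Type*} {G : ColoredGraph V E} {d : DirectionNetwork E}

/-! ### The two equivalences -/

theorem isReflectionLaman_iff : G.IsReflectionLaman ↔
    (Nat.card E : ℤ) = 2 * Nat.card V - 1 ∧ G.SatisfiesCount 1 Set.univ := by
  simp [IsReflectionLaman, SatisfiesCount]

theorem isRossSubgraph_iff {A : Set E} : G.IsRossSubgraph A ↔
    (A.ncard : ℤ) = 2 * Nat.card V - 2 ∧ G.SatisfiesCount 2 A := Iff.rfl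

theorem finrank_positions [Finite V] : Module.finrank ℝ (V → ℝ × ℝ) = 2 * Nat.card V := by
  have := Fintype.ofFinite V
  rw [Module.finrank_pi_fintype]
  simp [mul_comm]

/-- The vertical translation. -/
def vertical (V : Type*) : V → ℝ × ℝ := fun _ => (0, 1)

@[simp] theorem edgeVec_vertical (e : E) : edgeVec (G.coverEnds e) (vertical V) = 0 := by
  simp [edgeVec_coverEnds, vertical]

theorem vertical_ne_zero [Nonempty V] : vertical V ≠ 0 := fun h => by
  have := congrFun h (Classical.arbitrary V)
  simp [vertical] at this

/-- Coincidence of the two lifts of a vertex puts it on the axis, so the solutions form at most the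
line of vertical translations; the rank is then the number `2n - 1` of equations. -/
theorem takesAllValues_of_onlyCollapsed [Finite V] [Nonempty V] [Finite E]
    (hcard : (Nat.card E : ℤ) = 2 * Nat.card V - 1) (hd : d.perp.OnlyCollapsed G) :
    TakesAllValues (G.edgeEquation dotForm d.vec) Set.univ := by
  refine takesAllValues_univ ?_
  have hle : commonKer (G.edgeEquation dotForm d.vec) Set.univ ≤ Submodule.span ℝ {vertical V} := by
    intro u hu
    rw [mem_commonKer] at hu
    have hc := hd (realize u) (DirectionNetwork.perp_isRealization_realize_iff.2
      fun e => hu e (Set.mem_univ e))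
    rw [Submodule.mem_span_singleton]
    refine ⟨(u (Classical.arbitrary V)).2, ?_⟩
    funext v
    have h1 := toPlane_injective (hc (v, 0) (v, 1))
    have h2 := toPlane_injective (hc (v, 0) (Classical.arbitrary V, 0))
    have h3 := congrArg Prod.fst h1
    have h4 := congrArg Prod.snd h2
    simp only [lift_fst, lift_snd, sgn_zero, sgn_one] at h3 h4
    ext
    · simp only [vertical, Pi.smul_apply, Prod.smul_fst, smul_eq_mul]
      linarith
    · simp [vertical, h4]
  have h1 := Submodule.finrank_mono hle
  rw [finrank_span_singleton vertical_ne_zero] at h1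
  rw [finrank_positions]
  omega

theorem isReflectionLaman_of_faithful [Finite V] [Nonempty V] [Finite E]
    (hcard : (Nat.card E : ℤ) = 2 * Nat.card V - 1) (hf : d.HasFaithful G)
    (hd : d.perp.OnlyCollapsed G) : G.IsReflectionLaman := by
  obtain ⟨p, hp⟩ := hf
  obtain ⟨u, rfl⟩ := exists_eq_realize hp.1.2
  obtain ⟨h1, h2⟩ := DirectionNetwork.isFaithfulRealization_realize_iff.1 hp
  rw [isReflectionLaman_iff]
  refine ⟨hcard, ?_⟩
  exact_mod_cast satisfiesCount_of_solutions (ℓ := 1) edgeEquation_congr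
    (takesAllValues_of_onlyCollapsed hcard hd) (fun C hC => hasSolutionSpace_dotForm_one hC)
    fun C hC φ hφ => hasSolutionSpace_dotForm_three h2 h1 hC hφ

theorem linearIndependent_position_vertical {u : V → ℝ × ℝ} {e : E}
    (he : edgeVec (G.coverEnds e) u ≠ 0) : LinearIndependent ℝ ![u, vertical V] := by
  have : Nonempty V := ⟨G.src e⟩
  rw [LinearIndependent.pair_iff]
  intro s t hst
  have h1 := congrArg (edgeVec (G.coverEnds e)) hst
  simp only [map_add, map_smul, edgeVec_vertical, smul_zero, add_zero, map_zero, smul_eq_zero,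
    he, or_false] at h1
  subst h1
  simpa [vertical_ne_zero] using hst

/-- Uniqueness speaks only of faithful realizations. For a solution `q`, however, `u + t • q` is
faithful for all but finitely many `t`, since each edge degenerates for at most one `t`. -/
theorem commonKer_le_span_of_unique [Finite E] {u : V → ℝ × ℝ}
    (hu : d.IsFaithfulRealization G (realize u))
    (huniq : ∀ q : V × ZMod 2 → Plane, d.IsFaithfulRealization G q →
      ∃ c t : ℝ, c ≠ 0 ∧ ∀ i, q i = c • realize u i + !₂[0, t]) :
    commonKer (G.edgeEquation detForm d.vec) Set.univ ≤ Submodule.span ℝ {u, vertical V} := by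
  intro q hq
  rw [mem_commonKer] at hq
  rw [DirectionNetwork.isFaithfulRealization_realize_iff] at hu
  obtain ⟨h1, h2⟩ := hu
  have hfin : {t : ℝ | t = 0 ∨ ∃ e, edgeVec (G.coverEnds e) (u + t • q) = 0}.Finite := by
    refine (Set.finite_singleton (0 : ℝ)).union (Set.Finite.subset (Set.finite_iUnion
      (f := fun e : E => {t : ℝ | edgeVec (G.coverEnds e) (u + t • q) = 0}) fun e => ?_) ?_)
    · refine Set.Subsingleton.finite ?_
      intro t ht t' ht'
      simp only [Set.mem_ofPred_eq, map_add, map_smul] at ht ht'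
      by_contra hne
      have h3 : (t - t') • edgeVec (G.coverEnds e) q = 0 := by
        rw [sub_smul, ← add_sub_add_left_eq_sub _ _ (edgeVec (G.coverEnds e) u), ht, ht', sub_zero]
      rw [smul_eq_zero, or_iff_right (sub_ne_zero.2 hne)] at h3
      rw [h3, smul_zero, add_zero] at ht
      exact h2 e ht
    · rintro t ⟨e, he⟩
      exact Set.mem_iUnion.2 ⟨e, he⟩
  obtain ⟨t, ht⟩ := hfin.exists_notMem
  simp only [Set.mem_ofPred_eq, not_or, not_exists] at ht
  obtain ⟨ht0, ht⟩ := ht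
  obtain ⟨c, s, -, hcs⟩ := huniq (realize (u + t • q))
    (DirectionNetwork.isFaithfulRealization_realize_iff.2 ⟨fun e => by
      have := hq e (Set.mem_univ e)
      rw [edgeEquation_apply] at this
      rw [map_add, map_smul, map_add, map_smul, h1, this, smul_zero, add_zero], ht⟩)
  have h3 : u + t • q = c • u + s • vertical V := by
    funext v
    have h4 := hcs (v, 0)
    have h5 := congrArg (fun z : Plane => z 0) h4
    have h6 := congrArg (fun z : Plane => z 1) h4
    simp [realize] at h5 h6
    ext <;> simp [vertical, h5, h6]
  rw [Submodule.mem_span_pair]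
  refine ⟨(c - 1) / t, s / t, ?_⟩
  have h4 : t • q = (c - 1) • u + s • vertical V := by
    rw [sub_smul, one_smul, ← add_right_inj u, h3]
    abel
  rw [← smul_right_injective _ ht0 |>.eq_iff]
  simp only [h4, smul_add, smul_smul, mul_div_cancel₀ _ ht0]

theorem exists_isRossSubgraph_of_uniqueFaithful [Finite V] [Nonempty V] [Finite E]
    (hf : d.HasUniqueFaithful G) : ∃ A : Set E, G.IsRossSubgraph A := by
  obtain ⟨p, hp, huniq⟩ := hf
  obtain ⟨u, rfl⟩ := exists_eq_realize hp.1.2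
  have hle := commonKer_le_span_of_unique hp huniq
  obtain ⟨h1, h2⟩ := DirectionNetwork.isFaithfulRealization_realize_iff.1 hp
  have hV : 0 < Nat.card V := Nat.card_pos
  have hrank : Module.finrank ℝ (commonKer (G.edgeEquation detForm d.vec) Set.univ) ≤ 2 := by
    classical
    refine (Submodule.finrank_mono hle).trans ?_
    have := finrank_span_finset_le_card (R := ℝ) ({u, vertical V} : Finset (V → ℝ × ℝ))
    rw [Finset.coe_pair] at this
    exact this.trans Finset.card_le_two
  obtain ⟨A, hA, hL⟩ := exists_takesAllValues (L := G.edgeEquation detForm d.vec)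
    (2 * Nat.card V - 2) (by rw [finrank_positions]; omega)
  refine ⟨A, isRossSubgraph_iff.2 ⟨by omega, ?_⟩⟩
  exact_mod_cast satisfiesCount_of_solutions (ℓ := 2) edgeEquation_congr hL
    (fun C hC => hasSolutionSpace_detForm_two h2 h1 hC)
    fun C hC φ hφ => hasSolutionSpace_detForm_three h2 h1 hC hφ

/-! ### Sufficiency of the counts -/

theorem SatisfiesCount.exists_stressFree [Finite V] {B : ℝ × ℝ →ₗ[ℝ] ℝ × ℝ →ₗ[ℝ] ℝ} {ℓ : ℤ}
    {A : Finset E} (h : G.SatisfiesCount ℓ A) (hB : IsReflectionForm B)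
    (hℓ : ℓ = 2 ∨ (ℓ = 1 ∧ B = dotForm)) : ∃ p, StressFree B G.coverEnds A p := by
  classical
  exact (h.isSparse (by omega) (by omega)).exists_stressFree hB hℓ

theorem takesAllValues_of_stressFree {B : ℝ × ℝ →ₗ[ℝ] ℝ × ℝ →ₗ[ℝ] ℝ} {A : Finset E}
    {p : V → ℝ × ℝ} (h : StressFree B G.coverEnds A p) :
    TakesAllValues (G.edgeEquation B fun e => edgeVec (G.coverEnds e) p) A := by
  intro w
  obtain ⟨x, hx⟩ := h.rowMap_surjective fun e => w e
  exact ⟨x, fun e he => congrFun hx ⟨e, he⟩⟩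

/-- A degenerate edge would have a zero row. -/
theorem edgeVec_ne_zero_of_stressFree [Fintype E] {B : ℝ × ℝ →ₗ[ℝ] ℝ × ℝ →ₗ[ℝ] ℝ} {p : V → ℝ × ℝ}
    (h : StressFree B G.coverEnds Finset.univ p) (e : E) : edgeVec (G.coverEnds e) p ≠ 0 := by
  intro h0
  obtain ⟨x, hx⟩ := takesAllValues_of_stressFree h fun _ => 1
  have := hx e (by simp)
  simp [h0] at this

theorem ofPosition_isFaithfulRealization {p : V → ℝ × ℝ}
    (hp : ∀ e, edgeVec (G.coverEnds e) p ≠ 0) :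
    (DirectionNetwork.ofPosition G p hp).IsFaithfulRealization G (realize p) := by
  rw [DirectionNetwork.isFaithfulRealization_realize_iff]
  refine ⟨fun e => ?_, hp⟩
  rw [DirectionNetwork.ofPosition_vec, detForm_apply]
  ring

/-- The `2n - 1` independent rows leave a line of solutions, which is that of the vertical
translations; these put all vertices at one point of the axis. -/
theorem ofPosition_perp_onlyCollapsed [Finite V] [Nonempty V] [Fintype E]
    (hcard : (Nat.card E : ℤ) = 2 * Nat.card V - 1) {p : V → ℝ × ℝ}
    (h : StressFree dotForm G.coverEnds Finset.univ p)
    (hp : ∀ e, edgeVec (G.coverEnds e) p ≠ 0) :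
    (DirectionNetwork.ofPosition G p hp).perp.OnlyCollapsed G := by
  intro q hq
  obtain ⟨u, rfl⟩ := exists_eq_realize hq.2
  rw [DirectionNetwork.perp_isRealization_realize_iff] at hq
  simp only [DirectionNetwork.ofPosition_vec] at hq
  set K := commonKer (G.edgeEquation dotForm fun e => edgeVec (G.coverEnds e) p)
    ((Finset.univ : Finset E) : Set E) with hK
  have hdim := (takesAllValues_of_stressFree h).finrank_commonKer
  rw [← hK, finrank_positions, Set.ncard_coe_finset, Finset.card_univ,
    ← Nat.card_eq_fintype_card] at hdim
  have hle : Submodule.span ℝ {vertical V} ≤ K := by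
    rw [Submodule.span_singleton_le_iff_mem, hK, mem_commonKer]
    intro e _
    rw [edgeEquation_apply, edgeVec_vertical, map_zero]
  have heq : Submodule.span ℝ {vertical V} = K := by
    apply Submodule.eq_of_le_of_finrank_le hle
    rw [finrank_span_singleton vertical_ne_zero]
    omega
  have hu : u ∈ Submodule.span ℝ {vertical V} := by
    rw [heq, hK, mem_commonKer]
    exact fun e _ => hq e
  obtain ⟨t, rfl⟩ := Submodule.mem_span_singleton.1 hu
  intro i j
  rw [realize, realize]
  congr 1
  ext <;> simp [vertical]

/-- The `2n - 2` independent rows of `A` leave a plane of solutions, already spanned by `p` and the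
vertical translation. -/
theorem ofPosition_unique [Finite V] [Fintype E] [Nonempty E] {A : Finset E}
    (hA : (A.card : ℤ) = 2 * Nat.card V - 2) {p : V → ℝ × ℝ}
    (h : StressFree detForm G.coverEnds A p)
    (hp : ∀ e, edgeVec (G.coverEnds e) p ≠ 0) :
    (DirectionNetwork.ofPosition G p hp).HasUniqueFaithful G := by
  refine ⟨realize p, ofPosition_isFaithfulRealization hp, fun q hq => ?_⟩
  obtain ⟨u, rfl⟩ := exists_eq_realize hq.1.2
  obtain ⟨h1, h2⟩ := DirectionNetwork.isFaithfulRealization_realize_iff.1 hq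
  simp only [DirectionNetwork.ofPosition_vec] at h1
  obtain ⟨e₀⟩ := ‹Nonempty E›
  set K := commonKer (G.edgeEquation detForm fun e => edgeVec (G.coverEnds e) p)
    (A : Set E) with hK
  have hdim := (takesAllValues_of_stressFree h).finrank_commonKer
  rw [← hK, finrank_positions, Set.ncard_coe_finset] at hdim
  have hle : Submodule.span ℝ (Set.range ![p, vertical V]) ≤ K := by
    rw [Submodule.span_le, Set.range_subset_iff]
    intro i
    rw [SetLike.mem_coe, hK, mem_commonKer]
    intro e _
    fin_cases i
    · simp only [Fin.zero_eta, Matrix.cons_val_zero, edgeEquation_apply, detForm_apply]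
      ring
    · simp
  have heq : Submodule.span ℝ (Set.range ![p, vertical V]) = K := by
    apply Submodule.eq_of_le_of_finrank_le hle
    rw [finrank_span_eq_card (linearIndependent_position_vertical (hp e₀)), Fintype.card_fin]
    omega
  have hu : u ∈ Submodule.span ℝ (Set.range ![p, vertical V]) := by
    rw [heq, hK, mem_commonKer]
    exact fun e _ => h1 e
  rw [Matrix.range_cons, Matrix.range_cons, Matrix.range_empty, Set.union_empty,
    Set.singleton_union, Submodule.mem_span_pair] at hu
  obtain ⟨c, t, rfl⟩ := hu
  refine ⟨c, t, ?_, fun i => ?_⟩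
  -- With `c = 0` only a vertical translation would remain, and every edge would degenerate.
  · rintro rfl
    apply h2 e₀
    simp
  · apply plane_ext <;> simp [realize, vertical]

end ColoredGraph

/-! ### The main theorem. -/

open ReflectionSparsity ColoredGraph in
theorem theorem4 {V E : Type*} [Finite V] [Finite E] (G : ColoredGraph V E)
    (hcard : (Nat.card E : ℤ) = 2 * Nat.card V - 1) :
    ((∃ d : DirectionNetwork E, d.HasFaithful G ∧ d.perp.OnlyCollapsed G) ↔
      G.IsReflectionLaman) ∧
    ((∃ d : DirectionNetwork E, d.HasUniqueFaithful G ∧ d.perp.OnlyCollapsed G) ↔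
      G.IsReflectionLaman ∧ ∃ B : Set E, G.IsRossSubgraph B) := by
  have := Fintype.ofFinite E
  have hV : Nonempty V := by
    rw [← not_isEmpty_iff]
    intro h
    rw [Nat.card_of_isEmpty (α := V)] at hcard
    omega
  have hVpos : 0 < Nat.card V := Nat.card_pos
  have hE : Nonempty E := by
    rw [← not_isEmpty_iff]
    intro h
    rw [Nat.card_of_isEmpty (α := E)] at hcard
    omega
  have hrigid : G.IsReflectionLaman →
      ∃ p, StressFree dotForm G.coverEnds Finset.univ p := fun h =>
    SatisfiesCount.exists_stressFree (ℓ := 1) (by simpa using (isReflectionLaman_iff.1 h).2)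
      isReflectionForm_dotForm (Or.inr ⟨rfl, rfl⟩)
  refine ⟨⟨?_, fun h => ?_⟩, ⟨?_, ?_⟩⟩
  · rintro ⟨d, hf, hd⟩
    exact isReflectionLaman_of_faithful hcard hf hd
  · obtain ⟨p, hp⟩ := hrigid h
    have hne := edgeVec_ne_zero_of_stressFree hp
    exact ⟨.ofPosition G p hne, ⟨_, ofPosition_isFaithfulRealization hne⟩,
      ofPosition_perp_onlyCollapsed hcard hp hne⟩
  · rintro ⟨d, hf, hd⟩
    exact ⟨isReflectionLaman_of_faithful hcard ⟨_, hf.choose_spec.1⟩ hd,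
      exists_isRossSubgraph_of_uniqueFaithful hf⟩
  · rintro ⟨h, A, hA⟩
    obtain ⟨p, hp⟩ := hrigid h
    rw [isRossSubgraph_iff] at hA
    lift A to Finset E using A.toFinite
    obtain ⟨q, hq⟩ := hA.2.exists_stressFree isReflectionForm_detForm (Or.inl rfl)
    -- The same directions have to serve both networks, so one position must be stress-free for the
    -- dot form on all edges and for the det form on the Ross subgraph.
    obtain ⟨r, hr, hr'⟩ := hp.exists_common hq
    have hne := edgeVec_ne_zero_of_stressFree hr
    rw [Set.ncard_coe_finset] at hA
    exact ⟨.ofPosition G r hne, ofPosition_unique hA.1 hr' hne,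
      ofPosition_perp_onlyCollapsed hcard hr hne⟩
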